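/- Let $1<p<3$, $\max\{1,\frac{3p}{5p-3}\}<q<3$, and write $p^*=\frac{3p}{3-p}$, $q^*=\frac{3q}{3-q}$. Let $p<r<p^*$, $\max\{1,\frac{(q^*-1)p}{q^*}\}<s<\frac{(q^*-1)p^*}{q^*}$ and $\lambda>0$. Let $W^{1,p}(\mathbb R^3)$ be the Sobolev space with the norm $\|u\|=\big(\int_{\mathbb R^3}(|\nabla u|^p+|u|^p)\,dx\big)^{1/p}$, and let $D^{1,q}(\mathbb R^3)\subset L^{q^*}(\mathbb R^3)$ be the completion of $C_0^\infty(\mathbb R^3)$ with respect to $\|\nabla u\|_{L^q}$. Then for every $u\in W^{1,p}(\mathbb R^3)$ the equation $-\Delta_q\phi=|u|^s$ has exactly one weak solution $\phi_u\in D^{1,q}(\mathbb R^3)$, that is, exactly one $\phi_u\in D^{1,q}(\mathbb R^3)$ with $$\int_{\mathbb R^3}|\nabla\phi_u|^{q-2}\nabla\phi_u\cdot\nabla v\,dx=\int_{\mathbb R^3}|u|^s v\,dx\qquad\text{for all }v\in D^{1,q}(\mathbb R^3),$$ where $|u|^sv$ is integrable for all such $v$. The functional $$\mathcal J(u)=\frac1p\int_{\mathbb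 R^3}\left(|\nabla u|^p+|u|^p\right)dx+\frac{\lambda(q-1)}{qs}\int_{\mathbb R^3}\phi_u|u|^s\,dx-\frac1r\int_{\mathbb R^3}|u|^r\,dx$$ is well defined (all the integrals converge), it belongs to $C^1(W^{1,p}(\mathbb R^3),\mathbb R)$, and for all $u,v\in W^{1,p}(\mathbb R^3)$ its Fréchet derivative is $$\mathcal J'(u)[v]=\int_{\mathbb R^3}\left(|\nabla u|^{p-2}\nabla u\cdot\nabla v+|u|^{p-2}uv\right)dx+\lambda\int_{\mathbb R^3}\phi_u|u|^{s-2}uv\,dx-\int_{\mathbb R^3}|u|^{r-2}uv\,dx,$$ where the integrands are integrable. -/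

import Mathlib

open MeasureTheory Set Filter Topology
open scoped ContDiff

noncomputable section

namespace SchrodingerPoisson

/-- Euclidean space `ℝ³`, with the Euclidean norm and Lebesgue measure. -/
abbrev E3 : Type := EuclideanSpace ℝ (Fin 3)

/-- The critical Sobolev exponent `t^* = 3t / (3 - t)` in dimension three. -/
def critExp (t : ℝ) : ℝ := 3 * t / (3 - t)

/-- `L^t(ℝ³; F)`, classes modulo almost everywhere equality. -/
abbrev LpR (F : Type) [NormedAddCommGroup F] (t : ℝ) : Type :=
  Lp F (ENNReal.ofReal t) (volume : Measure E3)

instance factOneLe {t : ℝ} [ht : Fact (t ∈ Ioo (1 : ℝ) 3)] :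
    Fact ((1 : ENNReal) ≤ ENNReal.ofReal t) :=
  ⟨ENNReal.one_le_ofReal.2 ht.out.1.le⟩

instance factOneLeCritExp {t : ℝ} [ht : Fact (t ∈ Ioo (1 : ℝ) 3)] :
    Fact ((1 : ENNReal) ≤ ENNReal.ofReal (critExp t)) := by
  refine ⟨ENNReal.one_le_ofReal.2 ?_⟩
  obtain ⟨h1, h3⟩ := ht.out
  rw [critExp, le_div_iff₀ (by linarith)]
  linarith

/-- The class `C_0^∞(ℝ³)` of smooth real functions with compact support. -/
def IsTest (ψ : E3 → ℝ) : Prop := ContDiff ℝ ∞ ψ ∧ HasCompactSupport ψ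

/-- `g` is the weak gradient of `u`: `∫ u ∇ψ = - ∫ ψ g` for all test functions `ψ`. -/
def IsWeakGradient (u : E3 → ℝ) (g : E3 → E3) : Prop :=
  ∀ ψ : E3 → ℝ, IsTest ψ → ∫ x, u x • gradient ψ x = - ∫ x, ψ x • g x

theorem IsTest.continuous_gradient {ψ : E3 → ℝ} (h : IsTest ψ) : Continuous (gradient ψ) :=
  (InnerProductSpace.toDual ℝ E3).symm.continuous.comp
    (h.1.continuous_fderiv (by simp))

theorem IsTest.hasCompactSupport_gradient {ψ : E3 → ℝ} (h : IsTest ψ) :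
    HasCompactSupport (gradient ψ) :=
  (h.2.fderiv (𝕜 := ℝ)).comp_left (g := (InnerProductSpace.toDual ℝ E3).symm) (map_zero _)

theorem integrable_smul_gradient {t : ℝ} [Fact ((1 : ENNReal) ≤ ENNReal.ofReal t)]
    (u : LpR ℝ t) {ψ : E3 → ℝ} (h : IsTest ψ) :
    Integrable (fun x => u x • gradient ψ x) :=
  ((Lp.memLp u).locallyIntegrable Fact.out).integrable_smul_right_of_hasCompactSupport
    h.continuous_gradient h.hasCompactSupport_gradient

theorem integrable_test_smul {t : ℝ} [Fact ((1 : ENNReal) ≤ ENNReal.ofReal t)]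
    (g : LpR E3 t) {ψ : E3 → ℝ} (h : IsTest ψ) :
    Integrable (fun x => ψ x • g x) :=
  ((Lp.memLp g).locallyIntegrable Fact.out).integrable_smul_left_of_hasCompactSupport
    h.1.continuous h.2

/-- The Sobolev space `W^{1,p}(ℝ³)`: pairs `(u, ∇u)` in `L^p(ℝ³) × L^p(ℝ³; ℝ³)` whose second
component is the weak gradient of the first. As a subspace of the `ℓ^p` product it carries
the norm `‖u‖ = (∫ |∇u|^p + |u|^p)^{1/p}`. -/
def W1 (p : ℝ) [Fact (p ∈ Ioo (1 : ℝ) 3)] :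
    Submodule ℝ (WithLp (ENNReal.ofReal p) (LpR ℝ p × LpR E3 p)) where
  carrier := {w | IsWeakGradient w.fst w.snd}
  zero_mem' := by
    intro ψ hψ
    have h1 : (fun x => (0 : LpR ℝ p) x • gradient ψ x) =ᵐ[volume] fun _ => 0 := by
      filter_upwards [Lp.coeFn_zero ℝ (ENNReal.ofReal p) (volume : Measure E3)] with x hx
      rw [hx]
      simp
    have h2 : (fun x => ψ x • (0 : LpR E3 p) x) =ᵐ[volume] fun _ => 0 := by
      filter_upwards [Lp.coeFn_zero E3 (ENNReal.ofReal p) (volume : Measure E3)] with x hx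
      rw [hx]
      simp
    simp only [WithLp.zero_fst, WithLp.zero_snd]
    rw [integral_congr_ae h1, integral_congr_ae h2]
    simp
  add_mem' := by
    intro a b ha hb ψ hψ
    have h1 : (fun x => (a.fst + b.fst : LpR ℝ p) x • gradient ψ x) =ᵐ[volume]
        fun x => a.fst x • gradient ψ x + b.fst x • gradient ψ x := by
      filter_upwards [Lp.coeFn_add a.fst b.fst] with x hx
      rw [hx, Pi.add_apply, add_smul]
    have h2 : (fun x => ψ x • (a.snd + b.snd : LpR E3 p) x) =ᵐ[volume]
        fun x => ψ x • a.snd x + ψ x • b.snd x := by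
      filter_upwards [Lp.coeFn_add a.snd b.snd] with x hx
      rw [hx, Pi.add_apply, smul_add]
    simp only [WithLp.add_fst, WithLp.add_snd]
    rw [integral_congr_ae h1, integral_congr_ae h2,
      integral_add (integrable_smul_gradient _ hψ) (integrable_smul_gradient _ hψ),
      integral_add (integrable_test_smul _ hψ) (integrable_test_smul _ hψ), ha ψ hψ, hb ψ hψ,
      neg_add]
  smul_mem' := by
    intro c a ha ψ hψ
    have h1 : (fun x => (c • a.fst : LpR ℝ p) x • gradient ψ x) =ᵐ[volume]
        fun x => c • (a.fst x • gradient ψ x) := by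
      filter_upwards [Lp.coeFn_smul c a.fst] with x hx
      rw [hx, Pi.smul_apply, smul_assoc]
    have h2 : (fun x => ψ x • (c • a.snd : LpR E3 p) x) =ᵐ[volume]
        fun x => c • (ψ x • a.snd x) := by
      filter_upwards [Lp.coeFn_smul c a.snd] with x hx
      rw [hx, Pi.smul_apply, smul_comm]
    simp only [WithLp.smul_fst, WithLp.smul_snd]
    rw [integral_congr_ae h1, integral_congr_ae h2, integral_smul, integral_smul, ha ψ hψ,
      smul_neg]

namespace W1

variable {p : ℝ} [Fact (p ∈ Ioo (1 : ℝ) 3)]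

/-- The function `u : ℝ³ → ℝ` underlying an element of `W^{1,p}(ℝ³)`. -/
def fn (u : W1 p) : E3 → ℝ := u.1.fst

/-- The weak gradient `∇u : ℝ³ → ℝ³` of an element of `W^{1,p}(ℝ³)`. -/
def grad (u : W1 p) : E3 → E3 := u.1.snd

end W1

/-- The pairs `(ψ, ∇ψ)` with `ψ ∈ C_0^∞(ℝ³)`, as elements of `L^{q^*}(ℝ³) × L^q(ℝ³; ℝ³)`. -/
def testPairs (q : ℝ) [Fact (q ∈ Ioo (1 : ℝ) 3)] :
    Submodule ℝ (LpR ℝ (critExp q) × LpR E3 q) where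
  carrier := {w | ∃ ψ : E3 → ℝ, IsTest ψ ∧ w.1 =ᵐ[volume] ψ ∧ w.2 =ᵐ[volume] gradient ψ}
  zero_mem' := by
    refine ⟨0, ⟨contDiff_const, HasCompactSupport.zero⟩, Lp.coeFn_zero _ _ _, ?_⟩
    have h : gradient (0 : E3 → ℝ) = 0 := by
      funext x
      simp [gradient]
    rw [h]
    exact Lp.coeFn_zero _ _ _
  add_mem' := by
    rintro a b ⟨ψ, hψ, h1, h2⟩ ⟨χ, hχ, h3, h4⟩
    refine ⟨ψ + χ, ⟨hψ.1.add hχ.1, hψ.2.add hχ.2⟩, ?_, ?_⟩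
    · exact (Lp.coeFn_add a.1 b.1).trans (h1.add h3)
    · have h : gradient (ψ + χ) = gradient ψ + gradient χ := by
        funext x
        simp only [gradient, Pi.add_apply]
        rw [fderiv_add (hψ.1.differentiable (by simp) x) (hχ.1.differentiable (by simp) x),
          map_add]
      rw [h]
      exact (Lp.coeFn_add a.2 b.2).trans (h2.add h4)
  smul_mem' := by
    rintro c a ⟨ψ, hψ, h1, h2⟩
    refine ⟨c • ψ, ⟨contDiff_const.smul hψ.1, hψ.2.smul_left (f := fun _ => c)⟩, ?_, ?_⟩
    · exact (Lp.coeFn_smul c a.1).trans (h1.const_smul c)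
    · have h : gradient (c • ψ) = c • gradient ψ := by
        funext x
        simp only [gradient, Pi.smul_apply]
        rw [fderiv_const_smul (hψ.1.differentiable (by simp) x), map_smulₛₗ]
        simp
      rw [h]
      exact (Lp.coeFn_smul c a.2).trans (h2.const_smul c)

/-- The space `D^{1,q}(ℝ³)`, `1 < q < 3`: the completion of `C_0^∞(ℝ³)` for the norm `‖∇ψ‖_q`,
realised as a space of functions through the Sobolev inequality `‖ψ‖_{q^*} ≤ C ‖∇ψ‖_q`, that is,
as the closure of the pairs `(ψ, ∇ψ)` in `L^{q^*}(ℝ³) × L^q(ℝ³; ℝ³)`. -/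
def D1 (q : ℝ) [Fact (q ∈ Ioo (1 : ℝ) 3)] : Submodule ℝ (LpR ℝ (critExp q) × LpR E3 q) :=
  (testPairs q).topologicalClosure

namespace D1

variable {q : ℝ} [Fact (q ∈ Ioo (1 : ℝ) 3)]

/-- The function underlying an element of `D^{1,q}(ℝ³)`. -/
def fn (φ : D1 q) : E3 → ℝ := φ.1.1

/-- The gradient of an element of `D^{1,q}(ℝ³)`. -/
def grad (φ : D1 q) : E3 → E3 := φ.1.2

end D1

variable {p q : ℝ} [Fact (p ∈ Ioo (1 : ℝ) 3)] [Fact (q ∈ Ioo (1 : ℝ) 3)]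

/-- `φ ∈ D^{1,q}(ℝ³)` is a weak solution of `-Δ_q φ = |u|^s`:
`∫ |∇φ|^{q-2} ∇φ · ∇v = ∫ |u|^s v` for all `v ∈ D^{1,q}(ℝ³)`. The first conjunct says that the
right-hand side is a well-defined functional of `v`. -/
def SolvesPoisson (s : ℝ) (u : W1 p) (φ : D1 q) : Prop :=
  ∀ v : D1 q,
    Integrable (fun x => |W1.fn u x| ^ s * D1.fn v x) ∧
      ∫ x, ‖D1.grad φ x‖ ^ (q - 2) * inner ℝ (D1.grad φ x) (D1.grad v x) =
        ∫ x, |W1.fn u x| ^ s * D1.fn v x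

open Classical in
/-- The solution `φ_u ∈ D^{1,q}(ℝ³)` of `-Δ_q φ = |u|^s` (zero, by convention, if there were
none). -/
def phi (q : ℝ) [Fact (q ∈ Ioo (1 : ℝ) 3)] (s : ℝ) (u : W1 p) : D1 q :=
  if h : ∃ φ : D1 q, SolvesPoisson s u φ then h.choose else 0

/-- The reduced functional
`J(u) = (1/p) ∫ (|∇u|^p + |u|^p) + (λ(q-1)/(qs)) ∫ φ_u |u|^s - (1/r) ∫ |u|^r`. -/
def J (q : ℝ) [Fact (q ∈ Ioo (1 : ℝ) 3)] (s r lam : ℝ) (u : W1 p) : ℝ :=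
  (1 / p) * (∫ x, (‖W1.grad u x‖ ^ p + |W1.fn u x| ^ p))
    + (lam * (q - 1) / (q * s)) * (∫ x, D1.fn (phi q s u) x * |W1.fn u x| ^ s)
    - (1 / r) * (∫ x, |W1.fn u x| ^ r)

end SchrodingerPoisson

end

open SchrodingerPoisson

/-!
The point is that the nonlocal term is a Legendre transform, so that no derivative of `u ↦ φ_u` is
ever needed.

The Dirichlet energy `B(φ) = (1/q) ∫ |∇φ|^q` on `X = D^{1,q}` is coercive, convex and differentiable
with derivative the `q`-Laplacian. It is moreover uniformly convex: for every `ε` there is `C` with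
`|a - b|^q ≤ ε (|a|^q + |b|^q) + C d(a, b)`, where `d(a, b)` is the Bregman distance of `|x|^q`, the
height of the function at `a` above its tangent at `b`. For vectors in `ℝ³` this follows from
homogeneity and compactness of the unit sphere, by one argument for all `1 < q < ∞`
(`exists_norm_sub_rpow_le_bregman`), and it integrates at once. Hence
(`IsUniformlyConvexEnergy`) minimising sequences of `B - ℓ` converge for each `ℓ` in the dual of `X`,
the equation `B' φ = ℓ` has exactly one solution `φ_ℓ`, and `ℓ ↦ φ_ℓ` is continuous. The function
`H(ℓ) = ℓ(φ_ℓ) - B(φ_ℓ) = sup_φ (ℓ(φ) - B(φ))` satisfies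
`0 ≤ H(k) - H(ℓ) - (k - ℓ)(φ_ℓ) ≤ (k - ℓ)(φ_k - φ_ℓ)`, so it is `C^1` with derivative
`k ↦ k(φ_ℓ)` (`IsUniformlyConvexEnergy.hasFDerivAt_legendre`). As `ℓ(φ_ℓ) = q B(φ_ℓ)`, one has
`H(ℓ) = ((q - 1)/q) ℓ(φ_ℓ)`, and the nonlocal term of the functional is `(λ/s) H(|u|^s)`.

All else is the differentiability of power maps `u ↦ |u|^s` between Lebesgue spaces
(`hasFDerivAt_normPow`), which the same tangent inequality reduces to continuity of
`u ↦ |u|^{s-2} u` (`continuous_dualityOp`), and the Sobolev embedding `W^{1,p} ⊂ L^t` for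
`p ≤ t ≤ p^*` (`W1.exists_embedding`), obtained from the Gagliardo–Nirenberg–Sobolev inequality for
test functions by mollification, truncation and Fatou's lemma. With `m` the conjugate exponent of
`q^*`, the bounds on `s` say that `p < s m < p^*`, so that `|u|^s ∈ L^m` acts on `L^{q^*}`.
-/

open MeasureTheory Set Filter Topology
open scoped ContDiff

noncomputable section

namespace SchrodingerPoisson

/-! ### Pointwise inequalities for powers of the norm -/

/-- A comparison principle for positively homogeneous functions of the same degree on a finite
dimensional space. By homogeneity it is a statement about the unit sphere; there the set
`{f ≥ ε g}` is compact and `h` is positive on it. -/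
theorem exists_le_mul_add_mul_of_homogeneous {V : Type*} [NormedAddCommGroup V] [NormedSpace ℝ V]
    [FiniteDimensional ℝ V] {f g h : V → ℝ} {d : ℝ} (hd : 0 < d)
    (hf : Continuous f) (hg : Continuous g) (hh : Continuous h)
    (hfd : ∀ c : ℝ, 0 < c → ∀ v, f (c • v) = c ^ d * f v)
    (hgd : ∀ c : ℝ, 0 < c → ∀ v, g (c • v) = c ^ d * g v)
    (hhd : ∀ c : ℝ, 0 < c → ∀ v, h (c • v) = c ^ d * h v)
    (hg0 : ∀ v, v ≠ 0 → 0 < g v) (hh0 : ∀ v, 0 ≤ h v)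
    (hfh : ∀ v, h v = 0 → f v ≤ 0) {ε : ℝ} (hε : 0 < ε) :
    ∃ C : ℝ, 0 < C ∧ ∀ v, f v ≤ ε * g v + C * h v := by
  have h2 : (2 : ℝ) ^ d ≠ 1 := (Real.one_lt_rpow (by norm_num) hd).ne'
  have hzero : ∀ k : V → ℝ, (∀ c : ℝ, 0 < c → ∀ v, k (c • v) = c ^ d * k v) → k 0 = 0 := by
    intro k hk
    have := hk 2 (by norm_num) 0
    rw [smul_zero] at this
    by_contra h0
    exact h2 (mul_right_cancel₀ h0 (by rw [one_mul, ← this]))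
  have hK : IsCompact (Metric.sphere (0 : V) 1 ∩ {v | ε * g v ≤ f v}) :=
    (isCompact_sphere 0 1).inter_right (isClosed_le (continuous_const.mul hg) hf)
  have hpos : ∀ v ∈ Metric.sphere (0 : V) 1 ∩ {v | ε * g v ≤ f v}, 0 < h v := by
    rintro v ⟨hv1, hv2⟩
    have hv0 : v ≠ 0 := ne_zero_of_mem_unit_sphere ⟨v, hv1⟩
    refine lt_of_le_of_ne (hh0 v) fun h0 => ?_
    have h3 := hfh v h0.symm
    have h4 : 0 < ε * g v := mul_pos hε (hg0 v hv0)
    have h5 : ε * g v ≤ f v := hv2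
    linarith
  obtain ⟨C, hC, hCK⟩ : ∃ C : ℝ, 0 < C ∧
      ∀ v ∈ Metric.sphere (0 : V) 1 ∩ {v | ε * g v ≤ f v}, f v ≤ C * h v := by
    obtain ⟨C, hC⟩ := hK.exists_bound_of_continuousOn (f := fun v => f v / h v)
      (hf.continuousOn.div hh.continuousOn fun v hv => (hpos v hv).ne')
    refine ⟨max C 1, by positivity, fun v hv => ?_⟩
    rw [← div_le_iff₀ (hpos v hv)]
    exact (le_abs_self _).trans ((hC v hv).trans (le_max_left _ _))
  refine ⟨C, hC, fun v => ?_⟩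
  rcases eq_or_ne v 0 with rfl | hv
  · simp [hzero f hfd, hzero g hgd, hzero h hhd]
  have hnv : 0 < ‖v‖ := norm_pos_iff.2 hv
  set w : V := ‖v‖⁻¹ • v with hw
  have hvw : v = ‖v‖ • w := by rw [hw, smul_inv_smul₀ hnv.ne']
  have hw1 : ‖w‖ = 1 := by rw [hw, norm_smul, norm_inv, norm_norm, inv_mul_cancel₀ hnv.ne']
  have hw0 : w ≠ 0 := by
    intro h0
    simp [h0] at hw1
  have key : f w ≤ ε * g w + C * h w := by
    by_cases hc : ε * g w ≤ f w
    · have h3 := hCK w ⟨by simpa using hw1, hc⟩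
      have h4 : 0 < ε * g w := mul_pos hε (hg0 w hw0)
      linarith
    · have h3 : 0 ≤ C * h w := mul_nonneg hC.le (hh0 w)
      push Not at hc
      linarith
  rw [hvw, hfd _ hnv, hgd _ hnv, hhd _ hnv]
  calc ‖v‖ ^ d * f w ≤ ‖v‖ ^ d * (ε * g w + C * h w) := by gcongr
    _ = _ := by ring

section NormPowers

variable {F : Type*} [NormedAddCommGroup F] [InnerProductSpace ℝ F]

/-- The duality map `x ↦ |x|^{s-2} x`, that is, `1/s` times the gradient of `|x|^s`. At `x = 0`
it vanishes for every `s`, whatever the value of `0 ^ (s - 2)`. -/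
def dualityMap (s : ℝ) (x : F) : F := ‖x‖ ^ (s - 2) • x

theorem norm_dualityMap {s : ℝ} (hs : 1 < s) (x : F) : ‖dualityMap s x‖ = ‖x‖ ^ (s - 1) := by
  rcases eq_or_ne x 0 with rfl | hx
  · simp [dualityMap, Real.zero_rpow (by linarith : s - 1 ≠ 0)]
  · have h : 0 < ‖x‖ := norm_pos_iff.2 hx
    rw [dualityMap, norm_smul, Real.norm_of_nonneg (by positivity)]
    nth_rw 2 [← Real.rpow_one ‖x‖]
    rw [← Real.rpow_add h]
    ring_nf

theorem inner_dualityMap_self {s : ℝ} (hs : 1 < s) (x : F) :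
    inner ℝ (dualityMap s x) x = ‖x‖ ^ s := by
  rcases eq_or_ne x 0 with rfl | hx
  · simp [Real.zero_rpow (by linarith : s ≠ 0)]
  · have h : 0 < ‖x‖ := norm_pos_iff.2 hx
    rw [dualityMap, real_inner_smul_left, real_inner_self_eq_norm_sq, ← Real.rpow_natCast,
      ← Real.rpow_add h]
    norm_num

theorem dualityMap_smul {s c : ℝ} (hc : 0 < c) (x : F) :
    dualityMap s (c • x) = c ^ (s - 1) • dualityMap s x := by
  have h : c ^ (s - 1) = c ^ (s - 2) * c := by
    nth_rw 3 [← Real.rpow_one c]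
    rw [← Real.rpow_add hc]
    ring_nf
  rw [dualityMap, dualityMap, norm_smul, Real.norm_of_nonneg hc.le,
    Real.mul_rpow hc.le (norm_nonneg x), smul_smul, smul_smul, h]
  ring_nf

theorem continuous_dualityMap {s : ℝ} (hs : 1 < s) : Continuous (dualityMap s : F → F) := by
  rw [continuous_iff_continuousAt]
  intro x
  rcases eq_or_ne x 0 with rfl | hx
  · have h0 : dualityMap s (0 : F) = 0 := by simp [dualityMap]
    rw [ContinuousAt, h0, tendsto_zero_iff_norm_tendsto_zero]
    simp_rw [norm_dualityMap hs]
    have : Continuous fun x : F => ‖x‖ ^ (s - 1) :=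
      continuous_norm.rpow_const fun _ => Or.inr (by linarith)
    simpa [Real.zero_rpow (by linarith : s - 1 ≠ 0)] using this.tendsto 0
  · exact (continuousAt_id.norm.rpow_const (Or.inl (norm_ne_zero_iff.2 hx))).smul continuousAt_id

/-- The Bregman distance of the convex function `|x|^s`: the amount by which it lies, at `a`, above
its tangent at `b`. -/
def bregman (s : ℝ) (a b : F) : ℝ :=
  ‖a‖ ^ s - ‖b‖ ^ s - s * inner ℝ (dualityMap s b) (a - b)

theorem bregman_eq {s : ℝ} (hs : 1 < s) (a b : F) :
    bregman s a b = ‖a‖ ^ s + (s - 1) * ‖b‖ ^ s - s * inner ℝ (dualityMap s b) a := by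
  rw [bregman, inner_sub_right, inner_dualityMap_self hs]
  ring

/-- The tangent inequality for `t ↦ t ^ s`, strict off the point of tangency. -/
theorem mul_rpow_sub_one_lt {s α β : ℝ} (hs : 1 < s) (hα : 0 ≤ α) (hβ : 0 < β) (hne : α ≠ β) :
    s * (β ^ (s - 1) * α) < α ^ s + (s - 1) * β ^ s := by
  have h := one_add_mul_self_lt_rpow_one_add (s := α / β - 1) (p := s)
    (by have : 0 ≤ α / β := by positivity
        linarith)
    (by rw [sub_ne_zero, Ne, div_eq_one_iff_eq hβ.ne']; exact hne) hs
  rw [add_sub_cancel, Real.div_rpow hα hβ.le] at h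
  have hb : 0 < β ^ s := by positivity
  have h2 := mul_lt_mul_of_pos_right h hb
  rw [div_mul_cancel₀ _ hb.ne'] at h2
  have h3 : β ^ (s - 1) = β ^ s / β := by rw [Real.rpow_sub hβ, Real.rpow_one]
  have h4 : (1 + s * (α / β - 1)) * β ^ s = s * (β ^ (s - 1) * α) - (s - 1) * β ^ s := by
    rw [h3]
    field_simp
    ring
  linarith

theorem bregman_nonneg {s : ℝ} (hs : 1 < s) (a b : F) : 0 ≤ bregman s a b := by
  rw [bregman_eq hs]
  have h1 : inner ℝ (dualityMap s b) a ≤ ‖b‖ ^ (s - 1) * ‖a‖ := by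
    rw [← norm_dualityMap hs b]
    exact real_inner_le_norm _ _
  have h2 : s * (‖b‖ ^ (s - 1) * ‖a‖) ≤ ‖a‖ ^ s + (s - 1) * ‖b‖ ^ s := by
    rcases (norm_nonneg b).eq_or_lt with hb | hb
    · rw [← hb, Real.zero_rpow (by linarith), Real.zero_rpow (by linarith)]
      have := Real.rpow_nonneg (norm_nonneg a) s
      simpa using this
    · rcases eq_or_ne ‖a‖ ‖b‖ with h | h
      · have : ‖b‖ ^ (s - 1) * ‖b‖ = ‖b‖ ^ s := by
          rw [← Real.rpow_add_one hb.ne']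
          ring_nf
        rw [h, this]
        linarith
      · exact (mul_rpow_sub_one_lt hs (norm_nonneg a) hb h).le
  have h3 := mul_le_mul_of_nonneg_left h1 (by linarith : 0 ≤ s)
  linarith

theorem eq_of_bregman_eq_zero {s : ℝ} (hs : 1 < s) {a b : F} (h : bregman s a b = 0) : a = b := by
  rw [bregman_eq hs] at h
  rcases (norm_nonneg b).eq_or_lt with hb | hb
  · have hb0 : b = 0 := norm_eq_zero.1 hb.symm
    subst hb0
    rw [norm_zero, Real.zero_rpow (by linarith), dualityMap, smul_zero, inner_zero_left] at h
    rw [mul_zero, mul_zero, add_zero, sub_zero, Real.rpow_eq_zero (norm_nonneg a) (by linarith)] at h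
    exact norm_eq_zero.1 h
  have h1 : inner ℝ (dualityMap s b) a ≤ ‖b‖ ^ (s - 1) * ‖a‖ := by
    rw [← norm_dualityMap hs b]
    exact real_inner_le_norm _ _
  have hab : ‖a‖ = ‖b‖ := by
    by_contra hne
    have h2 := mul_rpow_sub_one_lt hs (norm_nonneg a) hb hne
    have h3 := mul_le_mul_of_nonneg_left h1 (by linarith : 0 ≤ s)
    linarith
  have h2 : ‖b‖ ^ s = ‖b‖ ^ (s - 2) * ‖b‖ ^ 2 := by
    rw [← Real.rpow_natCast, ← Real.rpow_add hb]
    norm_num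
  have h5 : inner ℝ b a = ‖b‖ ^ 2 := by
    rw [hab, dualityMap, real_inner_smul_left, h2] at h
    have h3 : 0 < s * ‖b‖ ^ (s - 2) := by positivity
    refine mul_left_cancel₀ h3.ne' ?_
    linarith
  rw [← sub_eq_zero, ← norm_eq_zero, ← sq_eq_zero_iff, norm_sub_sq_real, real_inner_comm, h5, hab]
  ring

theorem bregman_smul {s c : ℝ} (hs : 1 < s) (hc : 0 < c) (a b : F) :
    bregman s (c • a) (c • b) = c ^ s * bregman s a b := by
  have h : c ^ s = c ^ (s - 1) * c := by
    rw [← Real.rpow_add_one hc.ne']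
    ring_nf
  rw [bregman_eq hs, bregman_eq hs, dualityMap_smul hc, real_inner_smul_left,
    real_inner_smul_right, norm_smul, norm_smul, Real.norm_of_nonneg hc.le,
    Real.mul_rpow hc.le (norm_nonneg _), Real.mul_rpow hc.le (norm_nonneg _), h]
  ring

variable [FiniteDimensional ℝ F]

/-- Uniform convexity of `|x|^s`, in a form that covers all `s > 1` at once. -/
theorem exists_norm_sub_rpow_le_bregman {s ε : ℝ} (hs : 1 < s) (hε : 0 < ε) :
    ∃ C : ℝ, 0 < C ∧ ∀ a b : F,
      ‖a - b‖ ^ s ≤ ε * (‖a‖ ^ s + ‖b‖ ^ s) + C * bregman s a b := by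
  have hs0 : 0 < s := by linarith
  have hn : ∀ k : F × F → F, Continuous k → Continuous fun v => ‖k v‖ ^ s := fun k hk =>
    hk.norm.rpow_const fun _ => Or.inr hs0.le
  have hsc : ∀ c : ℝ, 0 < c → ∀ v : F, ‖c • v‖ ^ s = c ^ s * ‖v‖ ^ s := by
    intro c hc v
    rw [norm_smul, Real.norm_of_nonneg hc.le, Real.mul_rpow hc.le (norm_nonneg _)]
  obtain ⟨C, hC, h⟩ := exists_le_mul_add_mul_of_homogeneous (V := F × F) (d := s)
    (f := fun v => ‖v.1 - v.2‖ ^ s) (g := fun v => ‖v.1‖ ^ s + ‖v.2‖ ^ s)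
    (h := fun v => bregman s v.1 v.2) hs0
    (hn _ (by fun_prop)) ((hn _ continuous_fst).add (hn _ continuous_snd))
    (((hn _ continuous_fst).sub (hn _ continuous_snd)).sub (continuous_const.mul
      (((continuous_dualityMap hs).comp continuous_snd).inner (by fun_prop))))
    (fun c hc v => by rw [Prod.smul_fst, Prod.smul_snd, ← smul_sub, hsc c hc])
    (fun c hc v => by rw [Prod.smul_fst, Prod.smul_snd, hsc c hc, hsc c hc, mul_add])
    (fun c hc v => by rw [Prod.smul_fst, Prod.smul_snd, bregman_smul hs hc])
    (fun v hv => by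
      rcases eq_or_ne v.1 0 with h1 | h1
      · have h2 : v.2 ≠ 0 := fun h2 => hv (Prod.ext h1 h2)
        have := norm_pos_iff.2 h2
        positivity
      · have := norm_pos_iff.2 h1
        positivity)
    (fun v => bregman_nonneg hs _ _)
    (fun v hv => by
      rw [eq_of_bregman_eq_zero hs hv, sub_self, norm_zero, Real.zero_rpow hs0.ne'])
    hε
  exact ⟨C, hC, fun a b => h (a, b)⟩

/-- A modulus of continuity of the duality map that scales correctly. -/
theorem exists_norm_dualityMap_sub_le {s ε : ℝ} (hs : 1 < s) (hε : 0 < ε) :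
    ∃ C : ℝ, 0 < C ∧ ∀ a b : F,
      ‖dualityMap s a - dualityMap s b‖ ≤ ε * ‖b‖ ^ (s - 1) + C * ‖a - b‖ ^ (s - 1) := by
  have hs0 : 0 < s - 1 := by linarith
  have hn : ∀ k : F × F → F, Continuous k → Continuous fun v => ‖k v‖ ^ (s - 1) := fun k hk =>
    hk.norm.rpow_const fun _ => Or.inr hs0.le
  have hsc : ∀ c : ℝ, 0 < c → ∀ v : F, ‖c • v‖ ^ (s - 1) = c ^ (s - 1) * ‖v‖ ^ (s - 1) := by
    intro c hc v
    rw [norm_smul, Real.norm_of_nonneg hc.le, Real.mul_rpow hc.le (norm_nonneg _)]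
  obtain ⟨C, hC, h⟩ := exists_le_mul_add_mul_of_homogeneous (V := F × F) (d := s - 1)
    (f := fun v => ‖dualityMap s v.1 - dualityMap s v.2‖)
    (g := fun v => ‖v.2‖ ^ (s - 1) + ‖v.1 - v.2‖ ^ (s - 1))
    (h := fun v => ‖v.1 - v.2‖ ^ (s - 1)) hs0
    (((continuous_dualityMap hs).comp continuous_fst).sub
      ((continuous_dualityMap hs).comp continuous_snd)).norm
    ((hn _ continuous_snd).add (hn _ (by fun_prop))) (hn _ (by fun_prop))
    (fun c hc v => by
      rw [Prod.smul_fst, Prod.smul_snd, dualityMap_smul hc, dualityMap_smul hc, ← smul_sub,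
        norm_smul, Real.norm_of_nonneg (by positivity)])
    (fun c hc v => by
      rw [Prod.smul_fst, Prod.smul_snd, ← smul_sub, hsc c hc, hsc c hc, mul_add])
    (fun c hc v => by rw [Prod.smul_fst, Prod.smul_snd, ← smul_sub, hsc c hc])
    (fun v hv => by
      rcases eq_or_ne v.2 0 with h1 | h1
      · have h2 : v.1 - v.2 ≠ 0 := by
          rw [h1, sub_zero]
          exact fun h2 => hv (Prod.ext h2 h1)
        have := norm_pos_iff.2 h2
        positivity
      · have := norm_pos_iff.2 h1
        positivity)
    (fun v => by positivity)
    (fun v hv => by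
      rw [Real.rpow_eq_zero (norm_nonneg _) hs0.ne', norm_eq_zero, sub_eq_zero] at hv
      simp [hv])
    hε
  refine ⟨ε + C, by positivity, fun a b => (h (a, b)).trans (le_of_eq ?_)⟩
  ring

end NormPowers

/-! ### Coercive, uniformly convex functionals and their Legendre transforms -/

/-- `B` is a coercive differentiable functional with derivative `B'`, uniformly convex in the sense
that its Bregman distance `B x - B y - B' y (x - y)` controls `‖x - y‖ ^ q` up to an arbitrarily
small multiple of `B x + B y`. -/
structure IsUniformlyConvexEnergy {X : Type*} [NormedAddCommGroup X] [NormedSpace ℝ X]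
    (q K : ℝ) (B : X → ℝ) (B' : X → X →L[ℝ] ℝ) : Prop where
  one_lt : 1 < q
  pos : 0 < K
  hasFDerivAt : ∀ x, HasFDerivAt B (B' x) x
  norm_rpow_le : ∀ x, ‖x‖ ^ q ≤ K * B x
  tangent_le : ∀ x y, B y + B' y (x - y) ≤ B x
  norm_sub_rpow_le : ∀ ε : ℝ, 0 < ε → ∃ C : ℝ, 0 < C ∧ ∀ x y,
    ‖x - y‖ ^ q ≤ ε * (B x + B y) + C * (B x - B y - B' y (x - y))

namespace IsUniformlyConvexEnergy

variable {X : Type*} [NormedAddCommGroup X] [NormedSpace ℝ X]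
  {q K : ℝ} {B : X → ℝ} {B' : X → X →L[ℝ] ℝ}

theorem nonneg (h : IsUniformlyConvexEnergy q K B B') (x : X) : 0 ≤ B x := by
  have h1 := h.norm_rpow_le x
  have h2 : 0 ≤ ‖x‖ ^ q := by positivity
  exact nonneg_of_mul_nonneg_right (h2.trans h1) h.pos

theorem continuous (h : IsUniformlyConvexEnergy q K B B') : Continuous B :=
  continuous_iff_continuousAt.2 fun x => (h.hasFDerivAt x).continuousAt

/-- Superlinear growth absorbs linear terms. -/
theorem exists_mul_norm_le (h : IsUniformlyConvexEnergy q K B B') {L : ℝ} (hL : 0 ≤ L) :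
    ∃ M : ℝ, ∀ x, L * ‖x‖ ≤ B x / 2 + M := by
  have hq : 0 < q - 1 := by linarith [h.one_lt]
  have hK := h.pos
  -- beyond the radius `T` one has `2 K L ‖x‖ ≤ ‖x‖ ^ q`
  set T : ℝ := (2 * K * L) ^ (q - 1)⁻¹ with hT
  have hT0 : 0 ≤ T := by positivity
  refine ⟨L * T, fun x => ?_⟩
  have hB := h.nonneg x
  rcases le_total ‖x‖ T with hx | hx
  · have := mul_le_mul_of_nonneg_left hx hL
    linarith
  · rcases (norm_nonneg x).eq_or_lt with h0 | h0
    · rw [← h0, mul_zero]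
      positivity
    have h1 : 2 * K * L ≤ ‖x‖ ^ (q - 1) := by
      calc 2 * K * L = T ^ (q - 1) := by
            rw [hT, ← Real.rpow_mul (by positivity), inv_mul_cancel₀ hq.ne', Real.rpow_one]
        _ ≤ _ := by gcongr
    have h2 : ‖x‖ ^ q = ‖x‖ ^ (q - 1) * ‖x‖ := by
      rw [← Real.rpow_add_one h0.ne']
      ring_nf
    have h3 := h.norm_rpow_le x
    have h4 : 2 * K * L * ‖x‖ ≤ K * B x := by
      calc _ ≤ ‖x‖ ^ (q - 1) * ‖x‖ := by gcongr
        _ ≤ _ := by rw [← h2]; exact h3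
    have h5 : K * (2 * (L * ‖x‖)) ≤ K * B x := by linarith
    have h6 := le_of_mul_le_mul_left h5 hK
    have : 0 ≤ L * T := by positivity
    linarith

/-- The direct method: a minimising sequence of `B - ℓ` is a Cauchy sequence, because the energy
gap at a midpoint is a sum of two Bregman distances. -/
theorem exists_deriv_eq [CompleteSpace X] (h : IsUniformlyConvexEnergy q K B B') (l : X →L[ℝ] ℝ) :
    ∃ x, B' x = l := by
  have hq0 : 0 < q := by linarith [h.one_lt]
  obtain ⟨M, hM⟩ := h.exists_mul_norm_le (norm_nonneg l)
  set E : X → ℝ := fun x => B x - l x with hE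
  have hEB : ∀ x, B x ≤ 2 * (E x + M) := by
    intro x
    have h1 := hM x
    have h2 : l x ≤ ‖l‖ * ‖x‖ := (le_abs_self _).trans (l.le_opNorm x)
    simp only [hE]
    linarith
  have hbdd : BddBelow (range E) := by
    refine ⟨-M, ?_⟩
    rintro _ ⟨x, rfl⟩
    have h1 := hEB x
    have h2 := h.nonneg x
    linarith
  set m : ℝ := sInf (range E) with hm
  have hmE : ∀ x, m ≤ E x := fun x => csInf_le hbdd ⟨x, rfl⟩
  have hex : ∀ n : ℕ, ∃ x, E x < m + 1 / ((n : ℝ) + 1) := by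
    intro n
    obtain ⟨_, ⟨x, rfl⟩, hx⟩ := Real.lt_sInf_add_pos (range_nonempty E)
      (by positivity : (0 : ℝ) < 1 / ((n : ℝ) + 1))
    exact ⟨x, hx⟩
  choose x hx using hex
  have hx1 : ∀ n, E (x n) ≤ m + 1 := fun n => (hx n).le.trans (by
    have : (0 : ℝ) ≤ n := Nat.cast_nonneg n
    gcongr
    rw [div_le_one (by positivity)]
    linarith)
  set R : ℝ := 2 * (m + 1 + M) with hR
  have hR0 : 0 ≤ R := (h.nonneg (x 0)).trans ((hEB _).trans (by have := hx1 0; linarith))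
  have hmid : ∀ a b : X, B a - B ((2 : ℝ)⁻¹ • (a + b))
      - B' ((2 : ℝ)⁻¹ • (a + b)) (a - (2 : ℝ)⁻¹ • (a + b)) ≤
      E a + E b - 2 * E ((2 : ℝ)⁻¹ • (a + b)) := by
    intro a b
    set c := (2 : ℝ)⁻¹ • (a + b) with hc
    have h1 := h.tangent_le b c
    have h2 : b - c = -(a - c) := by
      rw [hc]
      module
    have h3 : l a + l b = 2 * l c := by
      rw [hc, map_smul, map_add, smul_eq_mul]
      ring
    rw [h2, map_neg] at h1
    simp only [hE]
    linarith
  have hcauchy : CauchySeq x := by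
    rw [Metric.cauchySeq_iff]
    intro δ hδ
    have hδq : 0 < (δ / 2) ^ q := by positivity
    set ε : ℝ := (δ / 2) ^ q / (4 * (R + 1)) with hε
    obtain ⟨C, hC, hCb⟩ := h.norm_sub_rpow_le ε (by positivity)
    obtain ⟨N, hN⟩ := exists_nat_one_div_lt (by positivity : 0 < (δ / 2) ^ q / (4 * C))
    refine ⟨N, fun a ha b hb => ?_⟩
    have hlt : ∀ n, N ≤ n → E (x n) ≤ m + 1 / ((N : ℝ) + 1) := fun n hn => (hx n).le.trans (by
      gcongr)
    set c := (2 : ℝ)⁻¹ • (x a + x b) with hc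
    have h1 := hmid (x a) (x b)
    rw [← hc] at h1
    have h2 := hlt a ha
    have h3 := hlt b hb
    have h4 := hmE c
    have h5 : B (x a) - B c - B' c (x a - c) ≤ 2 * (1 / ((N : ℝ) + 1)) := by linarith
    have h6 := h.tangent_le (x a) c
    have hBa : B (x a) ≤ R := (hEB _).trans (by have := hx1 a; linarith)
    have hBc : B c ≤ R := (hEB _).trans (by
      have := hx1 a
      have := hx1 b
      linarith)
    have h7 := hCb (x a) c
    have h8 : ‖x a - c‖ ^ q < (δ / 2) ^ q := by
      have e1 : ε * (B (x a) + B c) ≤ ε * (2 * (R + 1)) := by gcongr; linarith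
      have e2 : ε * (2 * (R + 1)) = (δ / 2) ^ q / 2 := by
        rw [hε]
        field_simp
        norm_num
      have e3 : C * (B (x a) - B c - B' c (x a - c)) ≤ C * (2 * (1 / ((N : ℝ) + 1))) := by gcongr
      have e4 : C * (2 * (1 / ((N : ℝ) + 1))) < C * (2 * ((δ / 2) ^ q / (4 * C))) := by gcongr
      have e5 : C * (2 * ((δ / 2) ^ q / (4 * C))) = (δ / 2) ^ q / 2 := by
        field_simp
        norm_num
      linarith
    have h9 : ‖x a - c‖ < δ / 2 := (Real.rpow_lt_rpow_iff (norm_nonneg _) (by positivity) hq0).1 h8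
    have h10 : x a - x b = (2 : ℝ) • (x a - c) := by
      rw [hc]
      module
    rw [dist_eq_norm, h10, norm_smul]
    norm_num
    linarith
  obtain ⟨y, hy⟩ := cauchySeq_tendsto_of_complete hcauchy
  have hEc : Continuous E := h.continuous.sub l.continuous
  have hEy : E y ≤ m := by
    have ht : Tendsto (fun n : ℕ => m + 1 / ((n : ℝ) + 1)) atTop (𝓝 (m + 0)) :=
      tendsto_const_nhds.add tendsto_one_div_add_atTop_nhds_zero_nat
    rw [add_zero] at ht
    exact le_of_tendsto_of_tendsto' ((hEc.tendsto y).comp hy) ht fun n => (hx n).le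
  refine ⟨y, ?_⟩
  have hmin : IsLocalMin E y := Eventually.of_forall fun z => hEy.trans (hmE z)
  have := hmin.hasFDerivAt_eq_zero ((h.hasFDerivAt y).sub l.hasFDerivAt)
  exact sub_eq_zero.1 this

theorem deriv_injective (h : IsUniformlyConvexEnergy q K B B') {x y : X} (hxy : B' x = B' y) :
    x = y := by
  have hq0 : 0 < q := by linarith [h.one_lt]
  rw [← sub_eq_zero, ← norm_eq_zero, ← Real.rpow_eq_zero (norm_nonneg _) hq0.ne']
  refine le_antisymm (le_of_forall_pos_le_add fun δ hδ => ?_) (by positivity)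
  have hx := h.nonneg x
  have hy := h.nonneg y
  obtain ⟨C, hC, hb⟩ := h.norm_sub_rpow_le (δ / (B x + B y + 1)) (by positivity)
  have h1 := h.tangent_le y x
  have h2 : B' x (y - x) = - B' y (x - y) := by rw [hxy, ← neg_sub, map_neg]
  have h3 : B x - B y - B' y (x - y) ≤ 0 := by linarith
  have h4 : C * (B x - B y - B' y (x - y)) ≤ 0 := mul_nonpos_of_nonneg_of_nonpos hC.le h3
  have h5 : δ / (B x + B y + 1) * (B x + B y) ≤ δ := by
    rw [div_mul_eq_mul_div, div_le_iff₀ (by positivity)]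
    exact mul_le_mul_of_nonneg_left (by linarith) hδ.le
  linarith [hb x y]

/-- The solution operator `ℓ ↦ x`, `B' x = ℓ`, of a uniformly convex energy is continuous. -/
theorem continuous_solution (h : IsUniformlyConvexEnergy q K B B') {S : (X →L[ℝ] ℝ) → X}
    (hS : ∀ l, B' (S l) = l) : Continuous S := by
  have hq0 : 0 < q := by linarith [h.one_lt]
  rw [continuous_iff_continuousAt]
  intro l
  obtain ⟨M, hM⟩ := h.exists_mul_norm_le (by positivity : 0 ≤ ‖l‖ + 1)
  -- solutions are bounded near `l`
  set R : ℝ := 2 * (B 0 + M) with hR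
  have hbd : ∀ k : X →L[ℝ] ℝ, ‖k‖ ≤ ‖l‖ + 1 → B (S k) ≤ R := by
    intro k hk
    have h1 := h.tangent_le 0 (S k)
    have h2 : B' (S k) (0 - S k) = - k (S k) := by rw [hS, zero_sub, map_neg]
    have h3 : k (S k) ≤ (‖l‖ + 1) * ‖S k‖ :=
      (le_abs_self _).trans ((k.le_opNorm _).trans (by gcongr))
    have h4 := hM (S k)
    linarith
  set D : ℝ := (K * R) ^ q⁻¹ with hD
  have hnbd : ∀ k : X →L[ℝ] ℝ, ‖k‖ ≤ ‖l‖ + 1 → ‖S k‖ ≤ D := by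
    intro k hk
    have h1 := (h.norm_rpow_le (S k)).trans (mul_le_mul_of_nonneg_left (hbd k hk) h.pos.le)
    exact (Real.le_rpow_inv_iff_of_pos (norm_nonneg _) (le_trans (by positivity) h1) hq0).2 h1
  have hR0 : 0 ≤ R := (h.nonneg _).trans (hbd l (by linarith))
  have hD0 : 0 ≤ D := (norm_nonneg _).trans (hnbd l (by linarith))
  rw [Metric.continuousAt_iff]
  intro δ hδ
  have hδq : 0 < δ ^ q := by positivity
  obtain ⟨C, hC, hb⟩ := h.norm_sub_rpow_le (δ ^ q / (4 * (R + 1))) (by positivity)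
  refine ⟨min 1 (δ ^ q / (4 * C * (D + 1))), by positivity, fun k hk => ?_⟩
  rw [dist_eq_norm, lt_min_iff] at hk
  have hkn : ‖k‖ ≤ ‖l‖ + 1 := by
    have := norm_le_norm_add_norm_sub' k l
    linarith [hk.1]
  have hln : ‖l‖ ≤ ‖l‖ + 1 := by linarith
  have h1 := h.tangent_le (S l) (S k)
  have h2 := hb (S k) (S l)
  rw [hS] at h1 h2
  have h3 : (k - l) (S k - S l) ≤ δ ^ q / (4 * C * (D + 1)) * (2 * D) := by
    refine (le_abs_self _).trans (((k - l).le_opNorm _).trans ?_)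
    have := norm_sub_le (S k) (S l)
    have := hnbd k hkn
    have := hnbd l hln
    gcongr
    · exact hk.2.le
    · linarith
  have h4 : B (S k) - B (S l) - l (S k - S l) ≤ (k - l) (S k - S l) := by
    have : k (S l - S k) = - k (S k - S l) := by rw [← neg_sub, map_neg]
    rw [_root_.sub_apply]
    linarith
  have h5 : C * (B (S k) - B (S l) - l (S k - S l)) ≤ δ ^ q / 2 * (D / (D + 1)) := by
    calc _ ≤ C * (δ ^ q / (4 * C * (D + 1)) * (2 * D)) := by gcongr; exact h4.trans h3
      _ = _ := by field_simp; ring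
  have h6 : δ ^ q / 2 * (D / (D + 1)) ≤ δ ^ q / 2 * 1 := by
    gcongr
    rw [div_le_one (by positivity)]
    linarith
  have h7 : δ ^ q / (4 * (R + 1)) * (B (S k) + B (S l)) ≤ δ ^ q / (4 * (R + 1)) * (2 * R) := by
    have := hbd k hkn
    have := hbd l hln
    gcongr
    linarith
  have h8 : δ ^ q / (4 * (R + 1)) * (2 * R) < δ ^ q / 2 := by
    rw [div_mul_eq_mul_div, div_lt_div_iff₀ (by positivity) (by norm_num)]
    nlinarith
  rw [dist_eq_norm]
  exact (Real.rpow_lt_rpow_iff (norm_nonneg _) hδ.le hq0).1 (by linarith)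

/-- The derivative of the Legendre transform `ℓ ↦ ℓ (S ℓ) - B (S ℓ)` of `B` at `ℓ` is evaluation
at `S ℓ`: no derivative of the solution operator `S` enters. -/
theorem hasFDerivAt_legendre (h : IsUniformlyConvexEnergy q K B B') {S : (X →L[ℝ] ℝ) → X}
    (hS : ∀ l, B' (S l) = l) (l : X →L[ℝ] ℝ) :
    HasFDerivAt (fun k => k (S k) - B (S k)) (ContinuousLinearMap.apply ℝ ℝ (S l)) l := by
  rw [hasFDerivAt_iff_isLittleO, Asymptotics.isLittleO_iff]
  intro c hc
  have hcont := (h.continuous_solution hS).continuousAt (x := l)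
  filter_upwards [Metric.continuousAt_iff'.1 hcont c hc] with k hk
  have h1 := h.tangent_le (S l) (S k)
  have h2 := h.tangent_le (S k) (S l)
  rw [hS, map_sub] at h1 h2
  have h3 : (k - l) (S k - S l) ≤ ‖k - l‖ * ‖S k - S l‖ :=
    (le_abs_self _).trans ((k - l).le_opNorm _)
  rw [dist_eq_norm] at hk
  have h4 : ‖k - l‖ * ‖S k - S l‖ ≤ c * ‖k - l‖ := by
    rw [mul_comm]
    gcongr
  simp only [_root_.sub_apply, map_sub, ContinuousLinearMap.apply_apply] at h3 ⊢
  rw [Real.norm_eq_abs, abs_le]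
  constructor
  · have : 0 ≤ c * ‖k - l‖ := by positivity
    linarith
  · linarith

end IsUniformlyConvexEnergy

/-! ### Superposition operators between Lebesgue spaces -/

section Superposition

variable {α : Type*} {mα : MeasurableSpace α} {μ : Measure α}
  {F : Type*} [NormedAddCommGroup F]
  {a b c : ENNReal} {s t : ℝ}

theorem memLp_norm_rpow (ht : 0 < t) (hab : b * ENNReal.ofReal t = a) {u : α → F}
    (hu : MemLp u a μ) : MemLp (fun x => ‖u x‖ ^ t) b μ := by
  refine ⟨(hu.1.norm.aemeasurable.pow_const t).aestronglyMeasurable, ?_⟩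
  rw [eLpNorm_norm_rpow u ht, hab]
  exact ENNReal.rpow_lt_top_of_nonneg ht.le hu.2.ne

/-- The operator `u ↦ |u|^t` from `L^{bt}` to `L^b`. -/
def normPow (ht : 0 < t) (hab : b * ENNReal.ofReal t = a) (u : Lp F a μ) : Lp ℝ b μ :=
  (memLp_norm_rpow ht hab (Lp.memLp u)).toLp

theorem coeFn_normPow (ht : 0 < t) (hab : b * ENNReal.ofReal t = a) (u : Lp F a μ) :
    normPow ht hab u =ᵐ[μ] fun x => ‖u x‖ ^ t :=
  MemLp.coeFn_toLp _

theorem norm_normPow (ht : 0 < t) (hab : b * ENNReal.ofReal t = a) (u : Lp F a μ) :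
    ‖normPow ht hab u‖ = ‖u‖ ^ t := by
  rw [normPow, Lp.norm_toLp, eLpNorm_norm_rpow _ ht, hab, Lp.norm_def, ENNReal.toReal_rpow]

theorem integrable_norm_rpow (ht : 0 < t) (u : Lp F (ENNReal.ofReal t) μ) :
    Integrable (fun x => ‖u x‖ ^ t) μ :=
  memLp_one_iff_integrable.1 (memLp_norm_rpow ht (one_mul _) (Lp.memLp u))

theorem integral_norm_rpow (ht : 0 < t) (u : Lp F (ENNReal.ofReal t) μ) :
    ∫ x, ‖u x‖ ^ t ∂μ = ‖u‖ ^ t := by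
  rw [← norm_normPow ht (one_mul (ENNReal.ofReal t)) u, L1.norm_eq_integral_norm]
  refine integral_congr_ae ?_
  filter_upwards [coeFn_normPow ht (one_mul (ENNReal.ofReal t)) u] with x hx
  rw [hx, Real.norm_of_nonneg (by positivity)]

variable [InnerProductSpace ℝ F]

theorem memLp_dualityMap (hs : 1 < s) (hab : b * ENNReal.ofReal (s - 1) = a) {u : α → F}
    (hu : MemLp u a μ) : MemLp (fun x => dualityMap s (u x)) b μ := by
  refine (memLp_norm_rpow (sub_pos.2 hs) hab hu).mono
    ((continuous_dualityMap hs).comp_aestronglyMeasurable hu.1) (Eventually.of_forall fun x => ?_)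
  rw [norm_dualityMap hs, Real.norm_of_nonneg (by positivity)]

/-- The operator `u ↦ |u|^{s-2} u` from `L^{b(s-1)}` to `L^b`. -/
def dualityOp (hs : 1 < s) (hab : b * ENNReal.ofReal (s - 1) = a) (u : Lp F a μ) : Lp F b μ :=
  (memLp_dualityMap hs hab (Lp.memLp u)).toLp

theorem coeFn_dualityOp (hs : 1 < s) (hab : b * ENNReal.ofReal (s - 1) = a) (u : Lp F a μ) :
    dualityOp hs hab u =ᵐ[μ] fun x => dualityMap s (u x) :=
  MemLp.coeFn_toLp _

theorem continuous_dualityOp [FiniteDimensional ℝ F] [Fact (1 ≤ a)] [Fact (1 ≤ b)] (hs : 1 < s)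
    (hab : b * ENNReal.ofReal (s - 1) = a) :
    Continuous (dualityOp hs hab : Lp F a μ → Lp F b μ) := by
  have hs1 : 0 < s - 1 := sub_pos.2 hs
  rw [continuous_iff_continuousAt]
  intro u
  rw [Metric.continuousAt_iff']
  intro δ hδ
  obtain ⟨C, hC, hb⟩ := exists_norm_dualityMap_sub_le (F := F) hs
    (by positivity : 0 < δ / (2 * (‖u‖ ^ (s - 1) + 1)))
  have hle : ∀ w : Lp F a μ, ‖dualityOp hs hab w - dualityOp hs hab u‖ ≤
      δ / (2 * (‖u‖ ^ (s - 1) + 1)) * ‖u‖ ^ (s - 1) + C * ‖w - u‖ ^ (s - 1) := by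
    intro w
    set G : Lp ℝ b μ := (δ / (2 * (‖u‖ ^ (s - 1) + 1))) • normPow hs1 hab u
      + C • normPow hs1 hab (w - u) with hG
    have h1 : ‖dualityOp hs hab w - dualityOp hs hab u‖ ≤ ‖G‖ := by
      refine Lp.norm_le_norm_of_ae_le ?_
      filter_upwards [Lp.coeFn_sub (dualityOp hs hab w) (dualityOp hs hab u),
        coeFn_dualityOp hs hab w, coeFn_dualityOp hs hab u,
        Lp.coeFn_add ((δ / (2 * (‖u‖ ^ (s - 1) + 1))) • normPow hs1 hab u)
          (C • normPow hs1 hab (w - u)),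
        Lp.coeFn_smul (δ / (2 * (‖u‖ ^ (s - 1) + 1))) (normPow hs1 hab u),
        Lp.coeFn_smul C (normPow hs1 hab (w - u)), coeFn_normPow hs1 hab u,
        coeFn_normPow hs1 hab (w - u), Lp.coeFn_sub w u] with x e1 e2 e3 e4 e5 e6 e7 e8 e9
      rw [e1, Pi.sub_apply, e2, e3, hG, e4, Pi.add_apply, e5, e6, Pi.smul_apply, Pi.smul_apply,
        e7, e8, e9, Pi.sub_apply, smul_eq_mul, smul_eq_mul]
      exact (hb (w x) (u x)).trans (le_abs_self _)
    refine h1.trans ((norm_add_le _ _).trans (le_of_eq ?_))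
    rw [norm_smul, norm_smul, norm_normPow, norm_normPow, Real.norm_of_nonneg hC.le,
      Real.norm_of_nonneg (by positivity)]
  have hlim : Tendsto (fun w : Lp F a μ => C * ‖w - u‖ ^ (s - 1)) (𝓝 u) (𝓝 0) := by
    have : Continuous fun w : Lp F a μ => C * ‖w - u‖ ^ (s - 1) :=
      continuous_const.mul ((by fun_prop : Continuous fun w : Lp F a μ => ‖w - u‖).rpow_const
        fun _ => Or.inr hs1.le)
    simpa [Real.zero_rpow hs1.ne'] using this.tendsto u
  filter_upwards [hlim.eventually_lt_const (by positivity : 0 < δ / 2)] with w hw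
  rw [dist_eq_norm]
  refine (hle w).trans_lt ?_
  have h2 : δ / (2 * (‖u‖ ^ (s - 1) + 1)) * ‖u‖ ^ (s - 1) ≤ δ / 2 := by
    rw [div_mul_eq_mul_div, div_le_div_iff₀ (by positivity) (by norm_num)]
    nlinarith [Real.rpow_nonneg (norm_nonneg u) (s - 1)]
  linarith

variable [Fact (1 ≤ a)] [Fact (1 ≤ b)] [Fact (1 ≤ c)] [ENNReal.HolderTriple b a c]

/-- The derivative of `u ↦ |u|^s` as an operator `L^a → L^c`, that is, `v ↦ s |u|^{s-2} u · v`. -/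
def normPowDeriv (c : ENNReal) [Fact (1 ≤ c)] [ENNReal.HolderTriple b a c]
    (hs : 1 < s) (hab : b * ENNReal.ofReal (s - 1) = a) (u : Lp F a μ) :
    Lp F a μ →L[ℝ] Lp ℝ c μ :=
  s • (innerSL ℝ (E := F)).holderL μ b a c (dualityOp hs hab u)

theorem coeFn_normPowDeriv (hs : 1 < s) (hab : b * ENNReal.ofReal (s - 1) = a) (u v : Lp F a μ) :
    normPowDeriv c hs hab u v =ᵐ[μ] fun x => s * inner ℝ (dualityMap s (u x)) (v x) := by
  rw [normPowDeriv, _root_.smul_apply, ContinuousLinearMap.holderL_apply_apply]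
  filter_upwards [Lp.coeFn_smul s ((innerSL ℝ (E := F)).holder c (dualityOp hs hab u) v),
    (innerSL ℝ (E := F)).coeFn_holder (r := c) (dualityOp hs hab u) v,
    coeFn_dualityOp hs hab u] with x h1 h2 h3
  rw [h1, Pi.smul_apply, h2, h3, smul_eq_mul, innerSL_apply_apply]

theorem continuous_normPowDeriv [FiniteDimensional ℝ F] (hs : 1 < s) (hab : b * ENNReal.ofReal (s - 1) = a) :
    Continuous (normPowDeriv c hs hab : Lp F a μ → _) :=
  (((innerSL ℝ (E := F)).holderL μ b a c).continuous.comp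
    (continuous_dualityOp hs hab)).const_smul s

/-- By convexity, the remainder in the first order expansion of `|u|^s` at `u` lies between `0` and
`s (|w|^{s-2} w - |u|^{s-2} u) · (w - u)`, so it suffices that the duality operator is continuous. -/
theorem hasFDerivAt_normPow [FiniteDimensional ℝ F] (hs : 1 < s) (hab : b * ENNReal.ofReal (s - 1) = a)
    (hac : c * ENNReal.ofReal s = a) (u : Lp F a μ) :
    HasFDerivAt (normPow (zero_lt_one.trans hs) hac : Lp F a μ → Lp ℝ c μ)
      (normPowDeriv c hs hab u) u := by
  have hs0 : 0 < s := zero_lt_one.trans hs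
  rw [hasFDerivAt_iff_isLittleO, Asymptotics.isLittleO_iff]
  intro δ hδ
  have hcont : Tendsto (normPowDeriv c hs hab) (𝓝 u) (𝓝 (normPowDeriv c hs hab u)) :=
    (continuous_normPowDeriv hs hab).tendsto u
  filter_upwards
    [(tendsto_iff_norm_sub_tendsto_zero (E := Lp F a μ →L[ℝ] Lp ℝ c μ).1 hcont).eventually_lt_const hδ] with w hw
  have h1 : ‖normPow hs0 hac w - normPow hs0 hac u - normPowDeriv c hs hab u (w - u)‖ ≤
      ‖(normPowDeriv c hs hab w - normPowDeriv c hs hab u) (w - u)‖ := by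
    rw [_root_.sub_apply]
    refine Lp.norm_le_norm_of_ae_le ?_
    filter_upwards [Lp.coeFn_sub (normPow hs0 hac w - normPow hs0 hac u)
        (normPowDeriv c hs hab u (w - u)),
      Lp.coeFn_sub (normPow hs0 hac w) (normPow hs0 hac u),
      Lp.coeFn_sub (normPowDeriv c hs hab w (w - u)) (normPowDeriv c hs hab u (w - u)),
      coeFn_normPow hs0 hac w, coeFn_normPow hs0 hac u,
      coeFn_normPowDeriv (c := c) hs hab u (w - u), coeFn_normPowDeriv (c := c) hs hab w (w - u),
      Lp.coeFn_sub w u] with x e1 e2 e3 e4 e5 e6 e7 e8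
    rw [e1, Pi.sub_apply, e2, e3, Pi.sub_apply, Pi.sub_apply, e4, e5, e6, e7, e8, Pi.sub_apply]
    have k1 := bregman_nonneg hs (w x) (u x)
    have k2 := bregman_nonneg hs (u x) (w x)
    rw [bregman] at k1 k2
    rw [← neg_sub (w x), inner_neg_right] at k2
    rw [Real.norm_of_nonneg k1]
    refine le_trans ?_ (le_abs_self _)
    linarith
  refine h1.trans ((ContinuousLinearMap.le_opNorm _ _).trans ?_)
  gcongr

end Superposition

/-! ### The functional `∫ |u|^s` on `L^s` -/

section Energy

variable {α : Type*} {mα : MeasurableSpace α} {μ : Measure α}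
  {F : Type*} [NormedAddCommGroup F] [InnerProductSpace ℝ F] {s : ℝ}

theorem holderConjugate_conjExponent (hs : 1 < s) :
    ENNReal.HolderConjugate (ENNReal.ofReal s.conjExponent) (ENNReal.ofReal s) :=
  (Real.HolderConjugate.conjExponent hs).symm.ennrealOfReal

theorem ofReal_conjExponent_mul (hs : 1 < s) :
    ENNReal.ofReal s.conjExponent * ENNReal.ofReal (s - 1) = ENNReal.ofReal s := by
  have h : 0 < s - 1 := by linarith
  rw [← ENNReal.ofReal_mul' h.le, Real.conjExponent, div_mul_cancel₀ _ h.ne']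

theorem integrable_inner_dualityMap (hs : 1 < s) (u v : Lp F (ENNReal.ofReal s) μ) :
    Integrable (fun x => inner ℝ (dualityMap s (u x)) (v x)) μ :=
  haveI := holderConjugate_conjExponent hs
  memLp_one_iff_integrable.1 ((innerSL ℝ (E := F)).memLp_of_bilin 1
    (memLp_dualityMap hs (ofReal_conjExponent_mul hs) (Lp.memLp u)) (Lp.memLp v))

variable [Fact (1 ≤ ENNReal.ofReal s)]

/-- The derivative `v ↦ s ∫ |u|^{s-2} u · v` of `u ↦ ∫ |u|^s` on `L^s`. -/
def energyDeriv (hs : 1 < s) (u : Lp F (ENNReal.ofReal s) μ) : Lp F (ENNReal.ofReal s) μ →L[ℝ] ℝ :=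
  haveI := holderConjugate_conjExponent hs
  haveI : Fact (1 ≤ ENNReal.ofReal s.conjExponent) :=
    ⟨ENNReal.HolderConjugate.one_le _ (ENNReal.ofReal s)⟩
  (L1.integralCLM' ℝ) ∘L normPowDeriv 1 hs (ofReal_conjExponent_mul hs) u

theorem energyDeriv_apply (hs : 1 < s) (u v : Lp F (ENNReal.ofReal s) μ) :
    energyDeriv hs u v = s * ∫ x, inner ℝ (dualityMap s (u x)) (v x) ∂μ := by
  have := holderConjugate_conjExponent hs
  have : Fact (1 ≤ ENNReal.ofReal s.conjExponent) :=
    ⟨ENNReal.HolderConjugate.one_le _ (ENNReal.ofReal s)⟩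
  rw [energyDeriv, ContinuousLinearMap.comp_apply, ← L1.integral_eq', L1.integral_eq_integral,
    integral_congr_ae (coeFn_normPowDeriv hs (ofReal_conjExponent_mul hs) u v),
    integral_const_mul]

theorem continuous_energyDeriv [FiniteDimensional ℝ F] (hs : 1 < s) :
    Continuous (energyDeriv hs : Lp F (ENNReal.ofReal s) μ → _) := by
  have := holderConjugate_conjExponent hs
  have : Fact (1 ≤ ENNReal.ofReal s.conjExponent) :=
    ⟨ENNReal.HolderConjugate.one_le _ (ENNReal.ofReal s)⟩
  exact (ContinuousLinearMap.postcomp (Lp F (ENNReal.ofReal s) μ)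
    (L1.integralCLM' (α := α) (E := ℝ) (μ := μ) ℝ)).continuous.comp
    (continuous_normPowDeriv hs (ofReal_conjExponent_mul hs))

theorem hasFDerivAt_energy [FiniteDimensional ℝ F] (hs : 1 < s) (u : Lp F (ENNReal.ofReal s) μ) :
    HasFDerivAt (fun w : Lp F (ENNReal.ofReal s) μ => ∫ x, ‖w x‖ ^ s ∂μ) (energyDeriv hs u) u := by
  have := holderConjugate_conjExponent hs
  have : Fact (1 ≤ ENNReal.ofReal s.conjExponent) :=
    ⟨ENNReal.HolderConjugate.one_le _ (ENNReal.ofReal s)⟩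
  have h := (L1.integralCLM' (α := α) (E := ℝ) (μ := μ) ℝ).hasFDerivAt.comp u
    (hasFDerivAt_normPow hs (ofReal_conjExponent_mul hs) (one_mul _) u)
  refine h.congr_of_eventuallyEq (Eventually.of_forall fun w => ?_)
  rw [Function.comp_apply, ← L1.integral_eq', L1.integral_eq_integral]
  exact (integral_congr_ae (coeFn_normPow _ _ w)).symm

theorem integral_bregman (hs : 1 < s) (u w : Lp F (ENNReal.ofReal s) μ) :
    Integrable (fun x => bregman s (u x) (w x)) μ ∧
      ∫ x, bregman s (u x) (w x) ∂μ =
        ∫ x, ‖u x‖ ^ s ∂μ - ∫ x, ‖w x‖ ^ s ∂μ - energyDeriv hs w (u - w) := by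
  have hs0 : 0 < s := by linarith
  have hae : (fun x => bregman s (u x) (w x)) =ᵐ[μ] fun x =>
      ‖u x‖ ^ s - ‖w x‖ ^ s - s * inner ℝ (dualityMap s (w x)) ((u - w) x) := by
    filter_upwards [Lp.coeFn_sub u w] with x hx
    rw [hx, Pi.sub_apply, bregman]
  have i1 := integrable_norm_rpow hs0 u
  have i2 := integrable_norm_rpow hs0 w
  have i3 := (integrable_inner_dualityMap hs w (u - w)).const_mul s
  refine ⟨((i1.sub i2).sub i3).congr hae.symm, ?_⟩
  rw [integral_congr_ae hae, integral_sub (by exact i1.sub i2) i3, integral_sub i1 i2, integral_const_mul,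
    energyDeriv_apply]

theorem energy_tangent_le (hs : 1 < s) (u w : Lp F (ENNReal.ofReal s) μ) :
    ∫ x, ‖w x‖ ^ s ∂μ + energyDeriv hs w (u - w) ≤ ∫ x, ‖u x‖ ^ s ∂μ := by
  have h := (integral_bregman hs u w).2
  have h0 : 0 ≤ ∫ x, bregman s (u x) (w x) ∂μ := integral_nonneg fun x => bregman_nonneg hs _ _
  linarith

theorem exists_norm_sub_rpow_le_energy [FiniteDimensional ℝ F] (hs : 1 < s) {ε : ℝ} (hε : 0 < ε) :
    ∃ C : ℝ, 0 < C ∧ ∀ u w : Lp F (ENNReal.ofReal s) μ,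
      ‖u - w‖ ^ s ≤ ε * (∫ x, ‖u x‖ ^ s ∂μ + ∫ x, ‖w x‖ ^ s ∂μ)
        + C * (∫ x, ‖u x‖ ^ s ∂μ - ∫ x, ‖w x‖ ^ s ∂μ - energyDeriv hs w (u - w)) := by
  have hs0 : 0 < s := by linarith
  obtain ⟨C, hC, hb⟩ := exists_norm_sub_rpow_le_bregman (F := F) hs hε
  refine ⟨C, hC, fun u w => ?_⟩
  obtain ⟨h1, h2⟩ := integral_bregman hs u w
  have i1 := integrable_norm_rpow hs0 u
  have i2 := integrable_norm_rpow hs0 w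
  rw [← h2, ← integral_norm_rpow hs0, ← integral_add i1 i2, ← integral_const_mul,
    ← integral_const_mul, ← integral_add (by exact (i1.add i2).const_mul ε) (h1.const_mul C)]
  refine integral_mono_ae (integrable_norm_rpow hs0 (u - w))
    (((i1.add i2).const_mul ε).add (h1.const_mul C)) ?_
  filter_upwards [Lp.coeFn_sub u w] with x hx
  rw [hx]
  exact hb _ _

end Energy

/-! ### Mollification and the Sobolev embedding -/

section Mollification

open scoped Convolution ENNReal

/-- Mollification does not increase `L^p` norms, by Jensen's inequality for the probability
measure whose density is the mollifier. -/
theorem eLpNorm_convolution_normed_le {F : Type*} [NormedAddCommGroup F] [NormedSpace ℝ F]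
    (φ : ContDiffBump (0 : E3)) {p : ℝ} (hp : 1 ≤ p) {g : E3 → F} (hg : StronglyMeasurable g) :
    eLpNorm (φ.normed volume ⋆[ContinuousLinearMap.lsmul ℝ ℝ, volume] g) (ENNReal.ofReal p) volume
      ≤ eLpNorm g (ENNReal.ofReal p) volume := by
  have hp0 : 0 < p := by linarith
  have hpe : (ENNReal.ofReal p).toReal = p := ENNReal.toReal_ofReal hp0.le
  set ρ : E3 → ℝ := φ.normed volume with hρ
  set ν : Measure E3 := volume.withDensity fun t => ‖ρ t‖ₑ with hν
  have hρm : Measurable fun t => ‖ρ t‖ₑ := φ.continuous_normed.measurable.enorm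
  have hprob : IsProbabilityMeasure ν := by
    refine ⟨?_⟩
    rw [hν, withDensity_apply _ MeasurableSet.univ, Measure.restrict_univ]
    have h1 : ∀ t, ‖ρ t‖ₑ = ENNReal.ofReal (ρ t) := fun t =>
      Real.enorm_of_nonneg (φ.nonneg_normed t)
    simp_rw [h1]
    rw [← ofReal_integral_eq_lintegral_ofReal φ.integrable_normed
      (Eventually.of_forall φ.nonneg_normed), φ.integral_normed, ENNReal.ofReal_one]
  have hgx : ∀ x, StronglyMeasurable fun t => g (x - t) := fun x =>
    hg.comp_measurable (measurable_const.sub measurable_id)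
  have hpt : ∀ x, ‖(ρ ⋆[ContinuousLinearMap.lsmul ℝ ℝ, volume] g) x‖ₑ ^ p ≤
      ∫⁻ t, ‖g (x - t)‖ₑ ^ p ∂ν := by
    intro x
    have h1 : ‖(ρ ⋆[ContinuousLinearMap.lsmul ℝ ℝ, volume] g) x‖ₑ ≤ ∫⁻ t, ‖g (x - t)‖ₑ ∂ν := by
      rw [hν, lintegral_withDensity_eq_lintegral_mul _ hρm (hgx x).enorm]
      refine (enorm_integral_le_lintegral_enorm _).trans (le_of_eq ?_)
      refine lintegral_congr fun t => ?_
      rw [ContinuousLinearMap.lsmul_apply, enorm_smul, Pi.mul_apply]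
    have h2 := eLpNorm_le_eLpNorm_of_exponent_le (ENNReal.one_le_ofReal.2 hp)
      (hgx x).aestronglyMeasurable (μ := ν)
    rw [eLpNorm_one_eq_lintegral_enorm, eLpNorm_eq_lintegral_rpow_enorm_toReal
      (ENNReal.ofReal_pos.2 hp0).ne' ENNReal.ofReal_ne_top, hpe] at h2
    have h3 := ENNReal.rpow_le_rpow (h1.trans h2) hp0.le
    rwa [← ENNReal.rpow_mul, one_div_mul_cancel hp0.ne', ENNReal.rpow_one] at h3
  rw [eLpNorm_eq_lintegral_rpow_enorm_toReal (ENNReal.ofReal_pos.2 hp0).ne' ENNReal.ofReal_ne_top,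
    eLpNorm_eq_lintegral_rpow_enorm_toReal (ENNReal.ofReal_pos.2 hp0).ne' ENNReal.ofReal_ne_top,
    hpe]
  refine ENNReal.rpow_le_rpow ?_ (by positivity)
  calc ∫⁻ x, ‖(ρ ⋆[ContinuousLinearMap.lsmul ℝ ℝ, volume] g) x‖ₑ ^ p
      ≤ ∫⁻ x, ∫⁻ t, ‖g (x - t)‖ₑ ^ p ∂ν := lintegral_mono hpt
    _ = ∫⁻ t, (∫⁻ x, ‖g (x - t)‖ₑ ^ p) ∂ν := by
      refine lintegral_lintegral_swap (f := fun x t => ‖g (x - t)‖ₑ ^ p) (Measurable.aemeasurable ?_)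
      exact ((hg.comp_measurable (measurable_fst.sub measurable_snd)).enorm).pow_const p
    _ = ∫⁻ _, (∫⁻ x, ‖g x‖ₑ ^ p) ∂ν :=
      lintegral_congr fun t => lintegral_sub_right_eq_self (fun x => ‖g x‖ₑ ^ p) t
    _ = ∫⁻ x, ‖g x‖ₑ ^ p := by rw [lintegral_const, measure_univ, mul_one]

theorem hasFDerivAt_convolution_of_isWeakGradient {u : E3 → ℝ} {g : E3 → E3}
    (hu : LocallyIntegrable u) (hg : LocallyIntegrable g) (h : IsWeakGradient u g)
    {ρ : E3 → ℝ} (hρ : IsTest ρ) (x : E3) :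
    HasFDerivAt (ρ ⋆[ContinuousLinearMap.lsmul ℝ ℝ, volume] u)
      (innerSL ℝ ((ρ ⋆[ContinuousLinearMap.lsmul ℝ ℝ, volume] g) x)) x := by
  set L : ℝ →L[ℝ] ℝ →L[ℝ] ℝ := ContinuousLinearMap.lsmul ℝ ℝ with hL
  have hd := hρ.2.hasFDerivAt_convolution_left L (hρ.1.of_le (by simp)) hu x
  suffices key : innerSL ℝ ((ρ ⋆[ContinuousLinearMap.lsmul ℝ ℝ, volume] g) x) =
      (fderiv ℝ ρ ⋆[L.precompL E3, volume] u) x by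
    rw [key]
    exact hd
  -- the test function whose weak derivative identity is used is `t ↦ ρ (x - t)`
  set ψ : E3 → ℝ := fun t => ρ (x - t) with hψ
  have hψt : IsTest ψ := by
    refine ⟨hρ.1.comp (contDiff_const.sub contDiff_id), ?_⟩
    exact hρ.2.comp_homeomorph (Homeomorph.subLeft x)
  have hgrad : ∀ t y, inner ℝ (gradient ψ t) y = - fderiv ℝ ρ (x - t) y := by
    intro t y
    have h1 : HasFDerivAt ψ ((fderiv ℝ ρ (x - t)).comp (-ContinuousLinearMap.id ℝ E3)) t :=
      ((hρ.1.differentiable (by simp) (x - t)).hasFDerivAt).comp t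
        ((hasFDerivAt_id t).const_sub x)
    rw [gradient, InnerProductSpace.toDual_symm_apply, h1.fderiv]
    simp
  have hi1 : Integrable fun t => u t • gradient ψ t :=
    hu.integrable_smul_right_of_hasCompactSupport hψt.continuous_gradient
      hψt.hasCompactSupport_gradient
  have hi2 : Integrable fun t => ψ t • g t :=
    hg.integrable_smul_left_of_hasCompactSupport hψt.1.continuous hψt.2
  ext1 y
  have hw := congrArg (fun z => inner ℝ y z) (h ψ hψt)
  simp only [inner_neg_right] at hw
  rw [← integral_inner hi1, ← integral_inner hi2] at hw
  have hconv : (ρ ⋆[ContinuousLinearMap.lsmul ℝ ℝ, volume] g) x = ∫ t, ψ t • g t := by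
    rw [convolution_eq_swap]
    rfl
  have hci : Integrable fun t => (L.precompL E3) (fderiv ℝ ρ (x - t)) (u t) :=
    (((hρ.2.fderiv (𝕜 := ℝ)).convolutionExists_left (L.precompL E3)
      (hρ.1.continuous_fderiv (by simp)) hu) x).integrable_swap
  rw [hconv, convolution_eq_swap, ContinuousLinearMap.integral_apply hci, innerSL_apply_apply,
    real_inner_comm, ← integral_inner hi2]
  have h3 : ∀ t, ((L.precompL E3) (fderiv ℝ ρ (x - t)) (u t)) y =
      - inner ℝ y (u t • gradient ψ t) := by
    intro t
    rw [ContinuousLinearMap.precompL_apply, real_inner_smul_right, real_inner_comm, hgrad, hL,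
      ContinuousLinearMap.lsmul_apply, smul_eq_mul]
    ring
  simp_rw [h3]
  rw [integral_neg, hw, neg_neg]

theorem norm_gradient (ψ : E3 → ℝ) (x : E3) : ‖gradient ψ x‖ = ‖fderiv ℝ ψ x‖ := by
  rw [gradient, LinearIsometryEquiv.norm_map]

/-- The Gagliardo–Nirenberg–Sobolev inequality in dimension three. -/
theorem exists_eLpNorm_critExp_le {p : ℝ} (hp : p ∈ Ioo (1 : ℝ) 3) :
    ∃ C : NNReal, ∀ ψ : E3 → ℝ, ContDiff ℝ 1 ψ → HasCompactSupport ψ →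
      eLpNorm ψ (ENNReal.ofReal (critExp p)) volume ≤
        C * eLpNorm (fderiv ℝ ψ) (ENNReal.ofReal p) volume := by
  refine ⟨SNormLESNormFDerivOfEqConst ℝ (volume : Measure E3) p.toNNReal, fun ψ h1 h2 => ?_⟩
  obtain ⟨hp1, hp3⟩ := hp
  refine eLpNorm_le_eLpNorm_fderiv_of_eq volume h1 h2 (p := p.toNNReal) (p' := (critExp p).toNNReal)
    (Real.one_le_toNNReal.2 hp1.le) (by simp) ?_
  have h3 : 0 < 3 - p := by linarith
  have hp0 : 0 < p := by linarith
  rw [NNReal.coe_inv, Real.coe_toNNReal _ hp0.le,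
    Real.coe_toNNReal _ (by unfold critExp; positivity), finrank_euclideanSpace, Fintype.card_fin,
    critExp]
  push_cast
  field_simp

/-- Sobolev's inequality in `W^{1,p}`: apply the inequality for test functions to mollified and
truncated functions, whose gradients are bounded in `L^p`, and use Fatou's lemma. -/
theorem exists_eLpNorm_critExp_le_of_isWeakGradient {p : ℝ} (hp : p ∈ Ioo (1 : ℝ) 3) :
    ∃ C : NNReal, ∀ (u : LpR ℝ p) (g : LpR E3 p), IsWeakGradient u g →
      eLpNorm u (ENNReal.ofReal (critExp p)) volume ≤
        C * (eLpNorm g (ENNReal.ofReal p) volume + eLpNorm u (ENNReal.ofReal p) volume) := by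
  obtain ⟨C, hC⟩ := exists_eLpNorm_critExp_le hp
  have hp1 : (1 : ℝ≥0∞) ≤ ENNReal.ofReal p := ENNReal.one_le_ofReal.2 hp.1.le
  -- cut-off functions `χ (x / (n + 1))`
  let χ : ContDiffBump (0 : E3) := ⟨1, 2, zero_lt_one, one_lt_two⟩
  let χs : ℕ → E3 → ℝ := fun n x => χ (((n : ℝ) + 1)⁻¹ • x)
  have hχd : ∀ n, ContDiff ℝ ∞ (χs n) := fun n =>
    χ.contDiff.comp (contDiff_id.const_smul _)
  have hχc : ∀ n, HasCompactSupport (χs n) := fun n =>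
    χ.hasCompactSupport.comp_smul (by positivity)
  obtain ⟨K, hK⟩ : ∃ K, ∀ x, ‖fderiv ℝ χ x‖ ≤ K :=
    (χ.hasCompactSupport.fderiv (𝕜 := ℝ)).exists_bound_of_continuous
      ((χ.contDiff (n := 1)).continuous_fderiv (by simp))
  have hK0 : 0 ≤ K := (norm_nonneg _).trans (hK 0)
  have hχK : ∀ n x, ‖fderiv ℝ (χs n) x‖ ≤ K := by
    intro n x
    have h1 : HasFDerivAt (χs n) ((fderiv ℝ χ (((n : ℝ) + 1)⁻¹ • x)).comp
        (((n : ℝ) + 1)⁻¹ • ContinuousLinearMap.id ℝ E3)) x :=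
      (((χ.contDiff (n := 1)).differentiable (by simp) _).hasFDerivAt).comp x
        ((((n : ℝ) + 1)⁻¹ • ContinuousLinearMap.id ℝ E3).hasFDerivAt)
    rw [h1.fderiv, ContinuousLinearMap.comp_smul, ContinuousLinearMap.comp_id, norm_smul]
    have h2 : ‖((n : ℝ) + 1)⁻¹‖ ≤ 1 := by
      rw [Real.norm_of_nonneg (by positivity)]
      exact inv_le_one_of_one_le₀ (by linarith [(Nat.cast_nonneg n : (0 : ℝ) ≤ n)])
    calc _ ≤ 1 * K := mul_le_mul h2 (hK _) (norm_nonneg _) zero_le_one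
      _ = K := one_mul K
  -- mollifiers
  let φ : ℕ → ContDiffBump (0 : E3) := fun n =>
    ⟨1 / ((n : ℝ) + 1), 2 * (1 / ((n : ℝ) + 1)), by positivity, by
      have : 0 < 1 / ((n : ℝ) + 1) := by positivity
      linarith⟩
  have hφ : Tendsto (fun n => (φ n).rOut) atTop (𝓝 0) := by
    have := (tendsto_one_div_add_atTop_nhds_zero_nat (𝕜 := ℝ)).const_mul 2
    rwa [mul_zero] at this
  refine ⟨C * (1 + K.toNNReal), fun u g hug => ?_⟩
  have hul : LocallyIntegrable u := (Lp.memLp u).locallyIntegrable hp1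
  have hgl : LocallyIntegrable g := (Lp.memLp g).locallyIntegrable hp1
  let U : ℕ → E3 → ℝ := fun n => (φ n).normed volume ⋆[ContinuousLinearMap.lsmul ℝ ℝ, volume] u
  let G : ℕ → E3 → E3 := fun n => (φ n).normed volume ⋆[ContinuousLinearMap.lsmul ℝ ℝ, volume] g
  have hρ : ∀ n, IsTest ((φ n).normed volume) := fun n =>
    ⟨(φ n).contDiff_normed, (φ n).hasCompactSupport_normed⟩
  have hUd : ∀ n, ContDiff ℝ ∞ (U n) := fun n =>
    (hρ n).2.contDiff_convolution_left _ (hρ n).1 hul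
  have hGc : ∀ n, Continuous (G n) := fun n =>
    (hρ n).2.continuous_convolution_left _ (hρ n).1.continuous hgl
  have hUG : ∀ n x, HasFDerivAt (U n) (innerSL ℝ (G n x)) x := fun n x =>
    hasFDerivAt_convolution_of_isWeakGradient hul hgl hug (hρ n) x
  have hlim : ∀ᵐ x, Tendsto (fun n => χs n x * U n x) atTop (𝓝 (u x)) := by
    filter_upwards [ContDiffBump.ae_convolution_tendsto_right_of_locallyIntegrable (μ := volume)
      (φ := φ) (K := 2) hφ (Eventually.of_forall fun n => le_rfl) hul] with x hx
    have h1 : Tendsto (fun n => χs n x) atTop (𝓝 1) := by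
      have h2 : Tendsto (fun n : ℕ => ((n : ℝ) + 1)⁻¹ • x) atTop (𝓝 ((0 : ℝ) • x)) := by
        have := tendsto_one_div_add_atTop_nhds_zero_nat (𝕜 := ℝ)
        simp only [one_div] at this
        exact this.smul_const x
      rw [zero_smul] at h2
      have h3 := (χ.continuous.tendsto 0).comp h2
      have h4 : χ 0 = 1 := χ.one_of_mem_closedBall (by simp [χ])
      rwa [h4] at h3
    simpa using h1.mul hx
  have hbound : ∀ n, eLpNorm (fun x => χs n x * U n x) (ENNReal.ofReal (critExp p)) volume ≤
      ↑(C * (1 + K.toNNReal)) *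
        (eLpNorm g (ENNReal.ofReal p) volume + eLpNorm u (ENNReal.ofReal p) volume) := by
    intro n
    have h1 := hC (fun x => χs n x * U n x) (((hχd n).mul (hUd n)).of_le (by simp))
      ((hχc n).mul_right)
    have h2 : eLpNorm (fderiv ℝ fun x => χs n x * U n x) (ENNReal.ofReal p) volume ≤
        eLpNorm (fun x => ‖G n x‖ + K * ‖U n x‖) (ENNReal.ofReal p) volume := by
      refine eLpNorm_mono_real fun x => ?_
      have h3 : HasFDerivAt (fun x => χs n x * U n x)
          (χs n x • innerSL ℝ (G n x) + U n x • fderiv ℝ (χs n) x) x :=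
        (((hχd n).differentiable (by simp) x).hasFDerivAt).mul (hUG n x)
      rw [h3.fderiv]
      refine (norm_add_le _ _).trans ?_
      rw [norm_smul, norm_smul, innerSL_apply_norm, mul_comm K]
      have h4 : ‖χs n x‖ ≤ 1 := by
        rw [Real.norm_of_nonneg χ.nonneg]
        exact χ.le_one
      exact add_le_add (mul_le_of_le_one_left (norm_nonneg _) h4)
        (mul_le_mul_of_nonneg_left (hχK n x) (norm_nonneg _))
    have h5 : eLpNorm (fun x => ‖G n x‖ + K * ‖U n x‖) (ENNReal.ofReal p) volume ≤
        eLpNorm (G n) (ENNReal.ofReal p) volume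
          + K.toNNReal * eLpNorm (U n) (ENNReal.ofReal p) volume := by
      refine (eLpNorm_add_le (hGc n).norm.aestronglyMeasurable
        ((hUd n).continuous.norm.const_smul K).aestronglyMeasurable hp1).trans ?_
      rw [eLpNorm_norm]
      gcongr
      rw [eLpNorm_const_smul, eLpNorm_norm, Real.enorm_of_nonneg hK0]
      rfl
    have h7 := eLpNorm_convolution_normed_le (φ n) hp.1.le (Lp.stronglyMeasurable g)
    have h8 := eLpNorm_convolution_normed_le (φ n) hp.1.le (Lp.stronglyMeasurable u)
    calc _ ≤ C * (eLpNorm g (ENNReal.ofReal p) volume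
          + K.toNNReal * eLpNorm u (ENNReal.ofReal p) volume) := by
          refine h1.trans ?_
          gcongr
          exact h2.trans (h5.trans (by gcongr))
      _ ≤ C * ((1 + K.toNNReal) * eLpNorm g (ENNReal.ofReal p) volume
          + (1 + K.toNNReal) * eLpNorm u (ENNReal.ofReal p) volume) := by
          gcongr
          · exact le_mul_of_one_le_left zero_le le_self_add
          · exact le_add_self
      _ = _ := by
          push_cast
          ring
  calc eLpNorm u (ENNReal.ofReal (critExp p)) volume
      ≤ atTop.liminf fun n =>
          eLpNorm (fun x => χs n x * U n x) (ENNReal.ofReal (critExp p)) volume :=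
        Lp.eLpNorm_lim_le_liminf_eLpNorm
          (fun n => ((hχd n).continuous.mul (hUd n).continuous).aestronglyMeasurable) _ hlim
    _ ≤ _ := liminf_le_of_le (by isBoundedDefault) fun b hb => by
        obtain ⟨n, hn⟩ := hb.exists
        exact hn.trans (hbound n)

end Mollification

section SobolevEmbedding

variable {p : ℝ} [Fact (p ∈ Ioo (1 : ℝ) 3)]

/-- The continuous linear map `u ↦ u` from `W^{1,p}` to `L^p`. -/
def W1.fnL : W1 p →L[ℝ] LpR ℝ p :=
  (WithLp.fstL (ENNReal.ofReal p) ℝ (LpR ℝ p) (LpR E3 p)) ∘L (W1 p).subtypeL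

/-- The continuous linear map `u ↦ ∇u` from `W^{1,p}` to `L^p`. -/
def W1.gradL : W1 p →L[ℝ] LpR E3 p :=
  (WithLp.sndL (ENNReal.ofReal p) ℝ (LpR ℝ p) (LpR E3 p)) ∘L (W1 p).subtypeL

/-- The linear map `u ↦ u` from `W^{1,p}` to a Lebesgue space that contains all of it. -/
def W1.toLpLinear {t : ℝ} (h : ∀ u : W1 p, MemLp (W1.fn u) (ENNReal.ofReal t) volume) :
    W1 p →ₗ[ℝ] LpR ℝ t where
  toFun u := (h u).toLp
  map_add' u v := by
    rw [← MemLp.toLp_add]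
    exact MemLp.toLp_congr _ _ (Lp.coeFn_add u.1.fst v.1.fst)
  map_smul' c u := by
    rw [RingHom.id_apply, ← MemLp.toLp_const_smul]
    exact MemLp.toLp_congr _ _ (Lp.coeFn_smul c u.1.fst)

theorem W1.coeFn_toLpLinear {t : ℝ}
    (h : ∀ u : W1 p, MemLp (W1.fn u) (ENNReal.ofReal t) volume) (u : W1 p) :
    W1.toLpLinear h u =ᵐ[volume] W1.fn u :=
  MemLp.coeFn_toLp (h u)

theorem W1.exists_memLp_critExp :
    ∃ (h : ∀ u : W1 p, MemLp (W1.fn u) (ENNReal.ofReal (critExp p)) volume) (C : ℝ),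
      0 ≤ C ∧ ∀ u, ‖W1.toLpLinear h u‖ ≤ C * ‖u‖ := by
  obtain ⟨C, hC⟩ := exists_eLpNorm_critExp_le_of_isWeakGradient (p := p) Fact.out
  have hlt : ∀ u : W1 p, C * (eLpNorm u.1.snd (ENNReal.ofReal p) volume
      + eLpNorm u.1.fst (ENNReal.ofReal p) volume) < ⊤ := fun u =>
    ENNReal.mul_lt_top ENNReal.coe_lt_top
      (ENNReal.add_lt_top.2 ⟨(Lp.memLp u.1.snd).2, (Lp.memLp u.1.fst).2⟩)
  have hm : ∀ u : W1 p, MemLp (W1.fn u) (ENNReal.ofReal (critExp p)) volume := fun u =>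
    ⟨(Lp.memLp u.1.fst).1, (hC _ _ u.2).trans_lt (hlt u)⟩
  refine ⟨hm, C * (‖W1.gradL (p := p)‖ + ‖W1.fnL (p := p)‖), by positivity, fun u => ?_⟩
  have h1 := ENNReal.toReal_mono (hlt u).ne (hC _ _ u.2)
  rw [ENNReal.toReal_mul, ENNReal.toReal_add (Lp.memLp u.1.snd).2.ne (Lp.memLp u.1.fst).2.ne,
    ENNReal.coe_toReal] at h1
  have h2 : ‖u.1.snd‖ ≤ ‖W1.gradL (p := p)‖ * ‖u‖ := (W1.gradL (p := p)).le_opNorm u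
  have h3 : ‖u.1.fst‖ ≤ ‖W1.fnL (p := p)‖ * ‖u‖ := (W1.fnL (p := p)).le_opNorm u
  calc ‖W1.toLpLinear hm u‖ = (eLpNorm u.1.fst (ENNReal.ofReal (critExp p)) volume).toReal :=
        Lp.norm_toLp _ (hm u)
    _ ≤ C * (‖u.1.snd‖ + ‖u.1.fst‖) := h1
    _ ≤ C * (‖W1.gradL (p := p)‖ * ‖u‖ + ‖W1.fnL (p := p)‖ * ‖u‖) := by gcongr
    _ = _ := by ring

/-- The Sobolev embedding `W^{1,p} ⊂ L^t` for `p ≤ t ≤ p^*`. Between the two end points it rests on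
`|u|^t ≤ |u|^p + |u|^{p^*}`, which bounds `u` in `L^t` on the unit ball of `W^{1,p}`. -/
theorem W1.exists_embedding {t : ℝ} [Fact ((1 : ENNReal) ≤ ENNReal.ofReal t)] (h1 : p ≤ t)
    (h2 : t ≤ critExp p) : ∃ T : W1 p →L[ℝ] LpR ℝ t, ∀ u, T u =ᵐ[volume] W1.fn u := by
  have hp : 1 < p := (Fact.out : p ∈ Ioo (1 : ℝ) 3).1
  have hp0 : 0 < p := by linarith
  have ht0 : 0 < t := by linarith
  have hc0 : 0 < critExp p := by linarith
  obtain ⟨hm, C, hC, hb⟩ := W1.exists_memLp_critExp (p := p)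
  have hpt : ∀ a : ℝ, 0 ≤ a → a ^ t ≤ a ^ p + a ^ critExp p := by
    intro a ha
    rcases le_total a 1 with h | h
    · rcases ha.eq_or_lt with h0 | h0
      · rw [← h0, Real.zero_rpow ht0.ne']
        positivity
      · have := Real.rpow_le_rpow_of_exponent_ge h0 h h1
        have : 0 ≤ a ^ critExp p := by positivity
        linarith
    · have := Real.rpow_le_rpow_of_exponent_le h h2
      have : 0 ≤ a ^ p := by positivity
      linarith
  have i1 : ∀ u : W1 p, Integrable fun x => ‖W1.fn u x‖ ^ p := fun u =>
    integrable_norm_rpow hp0 u.1.fst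
  have i2 : ∀ u : W1 p, Integrable fun x => ‖W1.fn u x‖ ^ critExp p := fun u =>
    memLp_one_iff_integrable.1 (memLp_norm_rpow hc0 (one_mul _) (hm u))
  have hmt : ∀ u : W1 p, MemLp (W1.fn u) (ENNReal.ofReal t) volume := by
    intro u
    have hu : AEStronglyMeasurable (W1.fn u) volume := (Lp.memLp u.1.fst).1
    rw [← integrable_norm_rpow_iff hu (ENNReal.ofReal_pos.2 ht0).ne' ENNReal.ofReal_ne_top,
      ENNReal.toReal_ofReal ht0.le]
    refine ((i1 u).add (i2 u)).mono' (hu.norm.aemeasurable.pow_const t).aestronglyMeasurable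
      (Eventually.of_forall fun x => ?_)
    rw [Real.norm_of_nonneg (by positivity)]
    exact hpt _ (norm_nonneg _)
  have hball : ∀ u ∈ Metric.ball (0 : W1 p) 1, ‖W1.toLpLinear hmt u‖ ≤
      (‖W1.fnL (p := p)‖ ^ p + C ^ critExp p) ^ t⁻¹ := by
    intro u hu
    have hu1 : ‖u‖ ≤ 1 := by
      rw [mem_ball_zero_iff] at hu
      exact hu.le
    rw [Real.le_rpow_inv_iff_of_pos (norm_nonneg _) (by positivity) ht0,
      ← integral_norm_rpow ht0]
    have e1 : ∫ x, ‖W1.toLpLinear hmt u x‖ ^ t = ∫ x, ‖W1.fn u x‖ ^ t := by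
      refine integral_congr_ae ?_
      filter_upwards [W1.coeFn_toLpLinear hmt u] with x hx
      rw [hx]
    have e2 : ∫ x, ‖W1.fn u x‖ ^ p = ‖W1.fnL u‖ ^ p := integral_norm_rpow hp0 u.1.fst
    have e3 : ∫ x, ‖W1.fn u x‖ ^ critExp p = ‖W1.toLpLinear hm u‖ ^ critExp p := by
      rw [← integral_norm_rpow hc0]
      refine integral_congr_ae ?_
      filter_upwards [W1.coeFn_toLpLinear hm u] with x hx
      rw [hx]
    have e4 : ‖W1.fnL u‖ ≤ ‖W1.fnL (p := p)‖ :=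
      ((W1.fnL (p := p)).le_opNorm u).trans (mul_le_of_le_one_right (W1.fnL (p := p)).opNorm_nonneg hu1)
    have e5 : ‖W1.toLpLinear hm u‖ ≤ C := (hb u).trans (mul_le_of_le_one_right hC hu1)
    calc ∫ x, ‖W1.toLpLinear hmt u x‖ ^ t
        ≤ ∫ x, (‖W1.fn u x‖ ^ p + ‖W1.fn u x‖ ^ critExp p) := by
          rw [e1]
          refine integral_mono_of_nonneg (Eventually.of_forall fun x => by positivity)
            ((i1 u).add (i2 u)) (Eventually.of_forall fun x => hpt _ (norm_nonneg _))
      _ = ‖W1.fnL u‖ ^ p + ‖W1.toLpLinear hm u‖ ^ critExp p := by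
          rw [integral_add (i1 u) (i2 u), e2, e3]
      _ ≤ _ := by gcongr
  obtain ⟨K, hK⟩ := LinearMap.bound_of_ball_bound zero_lt_one _ (W1.toLpLinear hmt) hball
  exact ⟨(W1.toLpLinear hmt).mkContinuous K hK, fun u => W1.coeFn_toLpLinear hmt u⟩

end SobolevEmbedding

/-! ### The `q`-Laplacian on `D^{1,q}` -/

section PLaplacian

variable {q : ℝ} [hqF : Fact (q ∈ Ioo (1 : ℝ) 3)]

/-- The norm of `D^{1,q}` as a subspace of `L^{q^*} × L^q`. This and the next instance repeat what
is known of submodules, so that spaces of operators into the dual of `D^{1,q}` are recognised as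
normed spaces. -/
instance D1.normedAddCommGroup : NormedAddCommGroup (D1 q) := (D1 q).normedAddCommGroup

instance D1.normedSpace : NormedSpace ℝ (D1 q) := (D1 q).normedSpace

instance D1.completeSpace : CompleteSpace (D1 q) :=
  inferInstanceAs (CompleteSpace (testPairs q).topologicalClosure)

/-- The continuous linear map `φ ↦ φ` from `D^{1,q}` to `L^{q^*}`. -/
def D1.fnL : D1 q →L[ℝ] LpR ℝ (critExp q) :=
  (ContinuousLinearMap.fst ℝ (LpR ℝ (critExp q)) (LpR E3 q)) ∘L (D1 q).subtypeL

/-- The continuous linear map `φ ↦ ∇φ` from `D^{1,q}` to `L^q`. -/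
def D1.gradL : D1 q →L[ℝ] LpR E3 q :=
  (ContinuousLinearMap.snd ℝ (LpR ℝ (critExp q)) (LpR E3 q)) ∘L (D1 q).subtypeL

theorem D1.exists_norm_le : ∃ C : ℝ, 0 < C ∧ ∀ φ : D1 q, ‖φ‖ ≤ C * ‖D1.gradL φ‖ := by
  obtain ⟨C, hC⟩ := exists_eLpNorm_critExp_le (p := q) Fact.out
  refine ⟨C + 1, by positivity, fun φ => ?_⟩
  have hcl : IsClosed {w : LpR ℝ (critExp q) × LpR E3 q | ‖w.1‖ ≤ C * ‖w.2‖} :=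
    isClosed_le continuous_fst.norm (continuous_const.mul continuous_snd.norm)
  have hsub : (testPairs q : Set (LpR ℝ (critExp q) × LpR E3 q)) ⊆ {w | ‖w.1‖ ≤ C * ‖w.2‖} := by
    rintro w ⟨ψ, hψ, h1, h2⟩
    have h3 : eLpNorm w.1 (ENNReal.ofReal (critExp q)) volume ≤
        C * eLpNorm w.2 (ENNReal.ofReal q) volume := by
      rw [eLpNorm_congr_ae h1, eLpNorm_congr_ae h2,
        eLpNorm_congr_norm_ae (Eventually.of_forall (norm_gradient ψ))]
      exact hC ψ (hψ.1.of_le (by simp)) hψ.2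
    have h4 := ENNReal.toReal_mono
      (ENNReal.mul_lt_top ENNReal.coe_lt_top (Lp.memLp w.2).2).ne h3
    rwa [ENNReal.toReal_mul, ENNReal.coe_toReal] at h4
  have hφ : ‖φ.1.1‖ ≤ C * ‖φ.1.2‖ := closure_minimal hsub hcl φ.2
  have hg : ‖D1.gradL φ‖ = ‖φ.1.2‖ := rfl
  have hC0 : (0 : ℝ) ≤ C := C.2
  have h0 := norm_nonneg φ.1.2
  rw [hg, Submodule.coe_norm, Prod.norm_def]
  refine max_le ?_ ?_
  · linarith
  · have := mul_nonneg hC0 h0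
    linarith

theorem one_lt_of_fact (q : ℝ) [hqF : Fact (q ∈ Ioo (1 : ℝ) 3)] : 1 < q := hqF.out.1

/-- The Dirichlet energy `(1/q) ∫ |∇φ|^q` of `D^{1,q}`. -/
def dirichlet (φ : D1 q) : ℝ := (1 / q) * ∫ x, ‖D1.grad φ x‖ ^ q

/-- The `q`-Laplacian, `v ↦ ∫ |∇φ|^{q-2} ∇φ · ∇v`, as an operator from `D^{1,q}` to its dual. -/
def qLaplacian (φ : D1 q) : D1 q →L[ℝ] ℝ :=
  (1 / q) • (energyDeriv (one_lt_of_fact q) (D1.gradL φ)) ∘L D1.gradL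

theorem qLaplacian_apply (φ v : D1 q) :
    qLaplacian φ v = ∫ x, ‖D1.grad φ x‖ ^ (q - 2) * inner ℝ (D1.grad φ x) (D1.grad v x) := by
  have hq0 : 0 < q := by linarith [one_lt_of_fact q]
  have h : qLaplacian φ v = (1 / q) * energyDeriv (one_lt_of_fact q) (D1.gradL φ) (D1.gradL v) :=
    rfl
  rw [h, energyDeriv_apply, ← mul_assoc, one_div_mul_cancel hq0.ne', one_mul]
  exact integral_congr_ae (Eventually.of_forall fun x => real_inner_smul_left _ _ _)

theorem isUniformlyConvexEnergy_dirichlet :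
    ∃ K, IsUniformlyConvexEnergy q K (dirichlet (q := q)) qLaplacian := by
  have hq : 1 < q := one_lt_of_fact q
  have hq0 : 0 < q := by linarith
  obtain ⟨C, hC, hb⟩ := D1.exists_norm_le (q := q)
  have hdir : ∀ φ : D1 q, ∫ x, ‖D1.gradL φ x‖ ^ q = q * dirichlet φ := by
    intro φ
    rw [dirichlet, ← mul_assoc, mul_one_div_cancel hq0.ne', one_mul]
    rfl
  have hlap : ∀ φ v : D1 q, energyDeriv hq (D1.gradL φ) (D1.gradL v) = q * qLaplacian φ v := by
    intro φ v
    have h : qLaplacian φ v = (1 / q) * energyDeriv hq (D1.gradL φ) (D1.gradL v) := rfl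
    rw [h, ← mul_assoc, mul_one_div_cancel hq0.ne', one_mul]
  have hpow : ∀ φ : D1 q, ‖φ‖ ^ q ≤ C ^ q * ‖D1.gradL φ‖ ^ q := by
    intro φ
    rw [← Real.mul_rpow hC.le (norm_nonneg _)]
    exact Real.rpow_le_rpow (norm_nonneg _) (hb φ) hq0.le
  refine ⟨C ^ q * q, hq, by positivity, fun φ => ?_, fun φ => ?_, fun φ ψ => ?_, fun ε hε => ?_⟩
  · exact ((hasFDerivAt_energy hq (D1.gradL φ)).comp φ D1.gradL.hasFDerivAt).const_mul (1 / q)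
  · refine (hpow φ).trans (le_of_eq ?_)
    rw [← integral_norm_rpow hq0, hdir]
    ring
  · have h := energy_tangent_le hq (D1.gradL φ) (D1.gradL ψ)
    rw [← map_sub, hlap, hdir, hdir, ← mul_add] at h
    exact le_of_mul_le_mul_left h hq0
  · obtain ⟨M, hM, h⟩ := exists_norm_sub_rpow_le_energy (μ := (volume : Measure E3)) (F := E3) hq
      (by positivity : 0 < ε / (C ^ q * q))
    refine ⟨C ^ q * (M * q), by positivity, fun φ ψ => ?_⟩
    have h1 := h (D1.gradL φ) (D1.gradL ψ)
    rw [← map_sub, hlap, hdir, hdir] at h1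
    refine (hpow (φ - ψ)).trans ((mul_le_mul_of_nonneg_left h1 (by positivity)).trans
      (le_of_eq ?_))
    field_simp

/-- The solution operator `ℓ ↦ φ` of `-Δ_q φ = ℓ` for `ℓ` in the dual of `D^{1,q}`. -/
def solve (l : D1 q →L[ℝ] ℝ) : D1 q :=
  ((isUniformlyConvexEnergy_dirichlet (q := q)).choose_spec.exists_deriv_eq l).choose

theorem qLaplacian_solve (l : D1 q →L[ℝ] ℝ) : qLaplacian (solve l) = l :=
  ((isUniformlyConvexEnergy_dirichlet (q := q)).choose_spec.exists_deriv_eq l).choose_spec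

theorem eq_solve_iff {l : D1 q →L[ℝ] ℝ} {φ : D1 q} : φ = solve l ↔ qLaplacian φ = l := by
  refine ⟨fun h => by rw [h, qLaplacian_solve], fun h => ?_⟩
  exact (isUniformlyConvexEnergy_dirichlet (q := q)).choose_spec.deriv_injective
    (h.trans (qLaplacian_solve l).symm)

theorem continuous_solve : Continuous (solve : (D1 q →L[ℝ] ℝ) → D1 q) :=
  (isUniformlyConvexEnergy_dirichlet (q := q)).choose_spec.continuous_solution qLaplacian_solve

/-- The Legendre transform of the Dirichlet energy is `ℓ ↦ (1 - 1/q) ℓ (φ_ℓ)`, because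
`ℓ (φ_ℓ) = ∫ |∇φ_ℓ|^q`; its derivative at `ℓ` is evaluation at `φ_ℓ`. -/
theorem hasFDerivAt_apply_solve (l : D1 q →L[ℝ] ℝ) :
    HasFDerivAt (fun k : D1 q →L[ℝ] ℝ => (q - 1) / q * k (solve k))
      (ContinuousLinearMap.apply ℝ ℝ (solve l)) l := by
  have hq : 1 < q := one_lt_of_fact q
  have hq0 : 0 < q := by linarith
  refine ((isUniformlyConvexEnergy_dirichlet (q := q)).choose_spec.hasFDerivAt_legendre
    qLaplacian_solve l).congr_of_eventuallyEq (Eventually.of_forall fun k => ?_)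
  have h1 : k (solve k) = q * dirichlet (solve k) := by
    nth_rw 1 [← qLaplacian_solve k]
    rw [qLaplacian_apply, dirichlet, ← mul_assoc, mul_one_div_cancel hq0.ne', one_mul]
    refine integral_congr_ae (Eventually.of_forall fun x => ?_)
    have := inner_dualityMap_self hq (D1.grad (solve k) x)
    rw [dualityMap, real_inner_smul_left] at this
    exact this
  simp only [h1]
  field_simp

end PLaplacian

/-! ### The three terms of the reduced functional -/

section ReducedFunctional

theorem inner_dualityMap_real (s a b : ℝ) : inner ℝ (dualityMap s a) b = |a| ^ (s - 2) * a * b := by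
  rw [dualityMap, real_inner_smul_left, Real.norm_eq_abs, mul_assoc]
  simp [mul_comm]

variable {p q : ℝ} [Fact (p ∈ Ioo (1 : ℝ) 3)] [Fact (q ∈ Ioo (1 : ℝ) 3)]

/-- The power `∫ |u|^r` is continuously differentiable on `W^{1,p}`, as it is on `L^r`. -/
theorem exists_hasFDerivAt_integral_rpow {r : ℝ} (h1 : p ≤ r) (h2 : r ≤ critExp p) :
    (∀ u : W1 p, Integrable fun x => |W1.fn u x| ^ r) ∧
    ∃ D : W1 p → W1 p →L[ℝ] ℝ, Continuous D ∧
      (∀ u, HasFDerivAt (fun w : W1 p => ∫ x, |W1.fn w x| ^ r) (D u) u) ∧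
      ∀ u v, Integrable (fun x => |W1.fn u x| ^ (r - 2) * W1.fn u x * W1.fn v x) ∧
        D u v = r * ∫ x, |W1.fn u x| ^ (r - 2) * W1.fn u x * W1.fn v x := by
  have hr : 1 < r := (one_lt_of_fact p).trans_le h1
  have : Fact ((1 : ENNReal) ≤ ENNReal.ofReal r) := ⟨ENNReal.one_le_ofReal.2 hr.le⟩
  obtain ⟨T, hT⟩ := W1.exists_embedding (p := p) h1 h2
  have hpow : ∀ u : W1 p, (fun x => ‖T u x‖ ^ r) =ᵐ[volume] fun x => |W1.fn u x| ^ r := by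
    intro u
    filter_upwards [hT u] with x hx
    rw [hx, Real.norm_eq_abs]
  have hinner : ∀ u v : W1 p, (fun x => inner ℝ (dualityMap r (T u x)) (T v x)) =ᵐ[volume]
      fun x => |W1.fn u x| ^ (r - 2) * W1.fn u x * W1.fn v x := by
    intro u v
    filter_upwards [hT u, hT v] with x hx hy
    rw [hx, hy, inner_dualityMap_real]
  refine ⟨fun u => (integrable_norm_rpow (by linarith) (T u)).congr (hpow u),
    fun u => energyDeriv hr (T u) ∘L T, ?_, fun u => ?_, fun u v => ?_⟩
  · exact (ContinuousLinearMap.precomp ℝ T).continuous.comp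
      ((continuous_energyDeriv hr).comp T.continuous)
  · exact ((hasFDerivAt_energy hr (T u)).comp u T.hasFDerivAt).congr_of_eventuallyEq
      (Eventually.of_forall fun w => (integral_congr_ae (hpow w)).symm)
  · refine ⟨(integrable_inner_dualityMap hr (T u) (T v)).congr (hinner u v), ?_⟩
    rw [ContinuousLinearMap.comp_apply, energyDeriv_apply, integral_congr_ae (hinner u v)]

/-- The `p`-th power of the norm of `W^{1,p}` is continuously differentiable. -/
theorem exists_hasFDerivAt_integral_sobolev :
    (∀ u : W1 p, Integrable fun x => ‖W1.grad u x‖ ^ p + |W1.fn u x| ^ p) ∧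
    ∃ D : W1 p → W1 p →L[ℝ] ℝ, Continuous D ∧
      (∀ u, HasFDerivAt
        (fun w : W1 p => ∫ x, (‖W1.grad w x‖ ^ p + |W1.fn w x| ^ p)) (D u) u) ∧
      ∀ u v, Integrable (fun x => ‖W1.grad u x‖ ^ (p - 2) * inner ℝ (W1.grad u x) (W1.grad v x)
          + |W1.fn u x| ^ (p - 2) * W1.fn u x * W1.fn v x) ∧
        D u v = p * ∫ x, (‖W1.grad u x‖ ^ (p - 2) * inner ℝ (W1.grad u x) (W1.grad v x)
          + |W1.fn u x| ^ (p - 2) * W1.fn u x * W1.fn v x) := by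
  have hp : 1 < p := one_lt_of_fact p
  have hpc : p ≤ critExp p := by
    have h3 : p < 3 := (Fact.out : p ∈ Ioo (1 : ℝ) 3).2
    rw [critExp, le_div_iff₀ (by linarith)]
    nlinarith
  obtain ⟨hi, D, hD, hDd, hDi⟩ := exists_hasFDerivAt_integral_rpow (p := p) le_rfl hpc
  have hg : ∀ u : W1 p, Integrable fun x => ‖W1.grad u x‖ ^ p := fun u =>
    integrable_norm_rpow (by linarith) (W1.gradL u)
  have hgi : ∀ u v : W1 p,
      (fun x => inner ℝ (dualityMap p (W1.gradL u x)) (W1.gradL v x)) =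
      fun x => ‖W1.grad u x‖ ^ (p - 2) * inner ℝ (W1.grad u x) (W1.grad v x) := fun u v =>
    funext fun x => real_inner_smul_left _ _ _
  have hgj : ∀ u v : W1 p, Integrable
      fun x => ‖W1.grad u x‖ ^ (p - 2) * inner ℝ (W1.grad u x) (W1.grad v x) := fun u v =>
    hgi u v ▸ integrable_inner_dualityMap hp (W1.gradL u) (W1.gradL v)
  refine ⟨fun u => (hg u).add (hi u), fun u => energyDeriv hp (W1.gradL u) ∘L W1.gradL + D u,
    ?_, fun u => ?_, fun u v => ⟨(hgj u v).add (hDi u v).1, ?_⟩⟩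
  · exact ((ContinuousLinearMap.precomp ℝ (W1.gradL (p := p))).continuous.comp
      ((continuous_energyDeriv hp).comp (W1.gradL (p := p)).continuous)).add hD
  · refine (((hasFDerivAt_energy hp (W1.gradL u)).comp u W1.gradL.hasFDerivAt).add
      (hDd u)).congr_of_eventuallyEq (Eventually.of_forall fun w => ?_)
    exact integral_add (hg w) (hi w)
  · rw [_root_.add_apply, (hDi u v).2, ContinuousLinearMap.comp_apply, energyDeriv_apply,
      hgi, integral_add (hgj u v) (hDi u v).1, mul_add]

/-- The source term `u ↦ |u|^s`, as a map from `W^{1,p}` to the dual of `D^{1,q}`, is continuously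
differentiable: `|u|^s` is taken in `L^m` with `m` the conjugate exponent of `q^*`, which asks for
`u ∈ L^{sm}`, and the bounds on `s` place `sm` between `p` and `p^*`. -/
theorem exists_hasFDerivAt_source {s : ℝ} (hs1 : 1 < s)
    (hs : (critExp q - 1) * p / critExp q ≤ s)
    (hs' : s ≤ (critExp q - 1) * critExp p / critExp q) :
    ∃ (N : W1 p → D1 q →L[ℝ] ℝ) (D : W1 p → W1 p →L[ℝ] D1 q →L[ℝ] ℝ), Continuous D ∧
      (∀ u, HasFDerivAt N (D u) u) ∧
      (∀ (u : W1 p) (φ : D1 q), Integrable (fun x => |W1.fn u x| ^ s * D1.fn φ x) ∧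
        N u φ = ∫ x, |W1.fn u x| ^ s * D1.fn φ x) ∧
      ∀ (u v : W1 p) (φ : D1 q),
        Integrable (fun x => D1.fn φ x * |W1.fn u x| ^ (s - 2) * W1.fn u x * W1.fn v x) ∧
        D u v φ = s * ∫ x, D1.fn φ x * |W1.fn u x| ^ (s - 2) * W1.fn u x * W1.fn v x := by
  have hQ : 1 < critExp q := by
    obtain ⟨h1, h3⟩ : q ∈ Ioo (1 : ℝ) 3 := Fact.out
    rw [critExp, lt_div_iff₀ (by linarith)]
    linarith
  have hQ1 : 0 < critExp q - 1 := by linarith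
  have hs0 : 0 < s := by linarith
  set m : ℝ := (critExp q).conjExponent with hm
  have hmul : m * ((critExp q - 1) / critExp q) = 1 := by
    rw [hm, Real.conjExponent]
    field_simp
  have hconj := Real.HolderConjugate.conjExponent hQ
  have hm1 : 1 < m := hconj.symm.lt
  have hm0 : 0 < m := by linarith
  have hpt : p ≤ s * m := by
    calc p = (critExp q - 1) * p / critExp q * m := by
          rw [mul_div_right_comm, mul_right_comm, mul_comm _ m, hmul, one_mul]
      _ ≤ s * m := by gcongr
  have htp : s * m ≤ critExp p := by
    calc s * m ≤ (critExp q - 1) * critExp p / critExp q * m := by gcongr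
      _ = critExp p := by
          rw [mul_div_right_comm, mul_right_comm, mul_comm _ m, hmul, one_mul]
  have ht : 1 < s * m := (one_lt_of_fact p).trans_le hpt
  have hss : 0 < s - 1 := by linarith
  have hb1 : 1 ≤ s * m / (s - 1) := by
    rw [le_div_iff₀ hss]
    nlinarith
  have : Fact ((1 : ENNReal) ≤ ENNReal.ofReal (s * m)) := ⟨ENNReal.one_le_ofReal.2 ht.le⟩
  have : Fact ((1 : ENNReal) ≤ ENNReal.ofReal m) := ⟨ENNReal.one_le_ofReal.2 hm1.le⟩
  have : Fact ((1 : ENNReal) ≤ ENNReal.ofReal (s * m / (s - 1))) :=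
    ⟨ENNReal.one_le_ofReal.2 hb1⟩
  have : ENNReal.HolderConjugate (ENNReal.ofReal m) (ENNReal.ofReal (critExp q)) :=
    hconj.symm.ennrealOfReal
  have hab : ENNReal.ofReal (s * m / (s - 1)) * ENNReal.ofReal (s - 1) = ENNReal.ofReal (s * m) := by
    rw [← ENNReal.ofReal_mul' hss.le, div_mul_cancel₀ _ hss.ne']
  have hac : ENNReal.ofReal m * ENNReal.ofReal s = ENNReal.ofReal (s * m) := by
    rw [← ENNReal.ofReal_mul' hs0.le, mul_comm]
  have : ENNReal.HolderTriple (ENNReal.ofReal (s * m / (s - 1))) (ENNReal.ofReal (s * m))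
      (ENNReal.ofReal m) := by
    refine ⟨?_⟩
    rw [← ENNReal.ofReal_inv_of_pos (by positivity), ← ENNReal.ofReal_inv_of_pos (by positivity),
      ← ENNReal.ofReal_inv_of_pos hm0, ← ENNReal.ofReal_add (by positivity) (by positivity)]
    congr 1
    field_simp
    ring
  obtain ⟨T, hT⟩ := W1.exists_embedding (p := p) hpt htp
  -- the pairing of `L^m` with `D^{1,q}`
  let P : LpR ℝ m →L[ℝ] LpR ℝ (critExp q) →L[ℝ] ℝ :=
    (ContinuousLinearMap.mul ℝ ℝ).lpPairing volume (ENNReal.ofReal m) (ENNReal.ofReal (critExp q))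
  let R : LpR ℝ m →L[ℝ] D1 q →L[ℝ] ℝ := (ContinuousLinearMap.precomp ℝ D1.fnL) ∘L P
  have hR : ∀ (f : LpR ℝ m) (φ : D1 q), Integrable (fun x => f x * D1.fn φ x) ∧
      R f φ = ∫ x, f x * D1.fn φ x := by
    intro f φ
    refine ⟨memLp_one_iff_integrable.1 ((ContinuousLinearMap.mul ℝ ℝ).memLp_of_bilin 1
      (Lp.memLp f) (Lp.memLp φ.1.1)), ?_⟩
    exact ContinuousLinearMap.lpPairing_eq_integral _ f φ.1.1
  refine ⟨fun u => R (normPow hs0 hac (T u)),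
    fun u => R ∘L (normPowDeriv (ENNReal.ofReal m) hs1 hab (T u) ∘L T), ?_, fun u => ?_,
    fun u φ => ?_, fun u v φ => ?_⟩
  · exact (ContinuousLinearMap.postcomp (W1 p) R).continuous.comp
      ((ContinuousLinearMap.precomp (LpR ℝ m) T).continuous.comp
        ((continuous_normPowDeriv hs1 hab).comp T.continuous))
  · exact R.hasFDerivAt.comp u ((hasFDerivAt_normPow hs1 hab hac (T u)).comp u T.hasFDerivAt)
  · obtain ⟨h1, h2⟩ := hR (normPow hs0 hac (T u)) φ
    have hae : (fun x => normPow hs0 hac (T u) x * D1.fn φ x) =ᵐ[volume]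
        fun x => |W1.fn u x| ^ s * D1.fn φ x := by
      filter_upwards [coeFn_normPow hs0 hac (T u), hT u] with x hx hy
      rw [hx, hy, Real.norm_eq_abs]
    exact ⟨h1.congr hae, h2.trans (integral_congr_ae hae)⟩
  · obtain ⟨h1, h2⟩ := hR (normPowDeriv (ENNReal.ofReal m) hs1 hab (T u) (T v)) φ
    have hae : (fun x => normPowDeriv (ENNReal.ofReal m) hs1 hab (T u) (T v) x * D1.fn φ x)
        =ᵐ[volume] fun x =>
          s * (D1.fn φ x * |W1.fn u x| ^ (s - 2) * W1.fn u x * W1.fn v x) := by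
      filter_upwards [coeFn_normPowDeriv (c := ENNReal.ofReal m) hs1 hab (T u) (T v), hT u,
        hT v] with x hx hy hz
      rw [hx, hy, hz, inner_dualityMap_real]
      ring
    refine ⟨?_, ?_⟩
    · have h3 := (h1.congr hae).const_mul s⁻¹
      simpa only [inv_mul_cancel_left₀ hs0.ne'] using h3
    · exact h2.trans ((integral_congr_ae hae).trans (integral_const_mul _ _))

end ReducedFunctional

end SchrodingerPoisson
end

open SchrodingerPoisson
theorem proposition2p3 (p q r s lam : ℝ)
    [Fact (p ∈ Ioo (1 : ℝ) 3)] [Fact (q ∈ Ioo (1 : ℝ) 3)]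
    (hq : 3 * p / (5 * p - 3) < q)
    (hr : p < r) (hr' : r < critExp p)
    (hs1 : 1 < s)
    (hs : (critExp q - 1) * p / critExp q < s)
    (hs' : s < (critExp q - 1) * critExp p / critExp q)
    (hlam : 0 < lam) :
    -- `φ_u` is well defined: it is the one and only solution
    (∀ (u : W1 p) (φ : D1 q), SolvesPoisson s u φ ↔ φ = phi q s u) ∧
    -- the integrals that define `J(u)` converge
    (∀ u : W1 p,
      Integrable (fun x => ‖W1.grad u x‖ ^ p + |W1.fn u x| ^ p) ∧
      Integrable (fun x => D1.fn (phi q s u) x * |W1.fn u x| ^ s) ∧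
      Integrable (fun x => |W1.fn u x| ^ r)) ∧
    -- `J` is continuously Fréchet differentiable
    ContDiff ℝ 1 (fun u : W1 p => J q s r lam u) ∧
    -- the formula for `J'(u)[v]`, whose integrals converge
    ∀ u v : W1 p,
      Integrable (fun x => ‖W1.grad u x‖ ^ (p - 2) * inner ℝ (W1.grad u x) (W1.grad v x)
        + |W1.fn u x| ^ (p - 2) * W1.fn u x * W1.fn v x) ∧
      Integrable (fun x => D1.fn (phi q s u) x
        * |W1.fn u x| ^ (s - 2) * W1.fn u x * W1.fn v x) ∧
      Integrable (fun x => |W1.fn u x| ^ (r - 2) * W1.fn u x * W1.fn v x) ∧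
      fderiv ℝ (fun w : W1 p => J q s r lam w) u v =
        (∫ x, (‖W1.grad u x‖ ^ (p - 2) * inner ℝ (W1.grad u x) (W1.grad v x)
          + |W1.fn u x| ^ (p - 2) * W1.fn u x * W1.fn v x))
        + lam * (∫ x, D1.fn (phi q s u) x
          * |W1.fn u x| ^ (s - 2) * W1.fn u x * W1.fn v x)
        - ∫ x, |W1.fn u x| ^ (r - 2) * W1.fn u x * W1.fn v x := by
  have hp1 : 1 < p := one_lt_of_fact p
  have hq1 : 1 < q := one_lt_of_fact q
  obtain ⟨hAi, A', hA'c, hA', hA'i⟩ := exists_hasFDerivAt_integral_sobolev (p := p)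
  obtain ⟨hBi, B', hB'c, hB', hB'i⟩ := exists_hasFDerivAt_integral_rpow (p := p) hr.le hr'.le
  obtain ⟨N, N', hN'c, hN', hN, hN'i⟩ :=
    exists_hasFDerivAt_source (p := p) (q := q) hs1 hs.le hs'.le
  have hsol : ∀ (u : W1 p) (φ : D1 q), SolvesPoisson s u φ ↔ φ = solve (N u) := by
    intro u φ
    rw [eq_solve_iff]
    constructor
    · intro h
      ext v
      rw [qLaplacian_apply, (h v).2, (hN u v).2]
    · intro h v
      refine ⟨(hN u v).1, ?_⟩
      rw [← qLaplacian_apply, h, (hN u v).2]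
  have hphi : ∀ u : W1 p, phi q s u = solve (N u) := by
    intro u
    have hex : ∃ φ : D1 q, SolvesPoisson s u φ := ⟨_, (hsol u _).2 rfl⟩
    rw [phi, dif_pos hex]
    exact (hsol u _).1 hex.choose_spec
  have hNcont : Continuous N := continuous_iff_continuousAt.2 fun u => (hN' u).continuousAt
  have hcomm : ∀ u : W1 p, (fun x => D1.fn (phi q s u) x * |W1.fn u x| ^ s) =
      fun x => |W1.fn u x| ^ s * D1.fn (phi q s u) x := fun u => funext fun x => mul_comm _ _
  let J' : W1 p → W1 p →L[ℝ] ℝ := fun u =>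
    (1 / p) • A' u + (lam / s) • (ContinuousLinearMap.apply ℝ ℝ (solve (N u)) ∘L N' u)
      - (1 / r) • B' u
  have hJ : ∀ u, HasFDerivAt (fun w : W1 p => J q s r lam w) (J' u) u := by
    intro u
    have h1 : HasFDerivAt (fun w => (q - 1) / q * N w (solve (N w)))
        (ContinuousLinearMap.apply ℝ ℝ (solve (N u)) ∘L N' u) u :=
      (hasFDerivAt_apply_solve (N u)).comp u (hN' u)
    refine ((((hA' u).const_mul (1 / p)).add (h1.const_mul (lam / s))).sub
      ((hB' u).const_mul (1 / r))).congr_of_eventuallyEq (Eventually.of_forall fun w => ?_)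
    have h2 : N w (solve (N w)) = ∫ x, D1.fn (phi q s w) x * |W1.fn w x| ^ s := by
      rw [hcomm, hphi, (hN w _).2]
    simp only [J, Pi.add_apply, Pi.sub_apply, h2]
    have hs0 : s ≠ 0 := by linarith
    have hq0 : q ≠ 0 := by linarith
    field_simp
  have hJ'c : Continuous J' := by
    have hsolve : Continuous fun u : W1 p =>
        (ContinuousLinearMap.apply ℝ ℝ (solve (N u)) : (D1 q →L[ℝ] ℝ) →L[ℝ] ℝ) :=
      (ContinuousLinearMap.apply ℝ ℝ : D1 q →L[ℝ] _).continuous.comp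
        (continuous_solve.comp hNcont)
    exact ((hA'c.const_smul (1 / p)).add ((hsolve.clm_comp hN'c).const_smul (lam / s))).sub
      (hB'c.const_smul (1 / r))
  refine ⟨fun u φ => by rw [hphi, hsol], fun u => ⟨hAi u, ?_, hBi u⟩,
    contDiff_one_iff_hasFDerivAt.2 ⟨J', hJ'c, hJ⟩,
    fun u v => ⟨(hA'i u v).1, (hN'i u v _).1, (hB'i u v).1, ?_⟩⟩
  · rw [hcomm]
    exact (hN u _).1
  · have h1 : J' u v = 1 / p * A' u v + lam / s * N' u v (solve (N u)) - 1 / r * B' u v := rfl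
    rw [(hJ u).fderiv, h1, (hA'i u v).2, (hB'i u v).2, (hN'i u v _).2, hphi]
    have hp0 : p ≠ 0 := by linarith
    have hs0 : s ≠ 0 := by linarith
    have hr0 : r ≠ 0 := by linarith
    field_simp
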